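/- **Conventions.** Algorithms are uniform unless stated otherwise; a probabilistic polynomial-time (PPT) algorithm computes its output in deterministic polynomial time from its input and polynomially many uniform coins. $\mathcal U_m$ is the uniform distribution on $\{0,1\}^m$, $\Delta_s(X;Y)=\frac12\sum_u|\Pr[X=u]-\Pr[Y=u]|$, and $\mathcal L_n=\mathcal L\cap\{0,1\}^n$. A polynomial-time oracle-aided algorithm $R$ is a single probabilistic oracle program whose number of steps on an input $x$ is bounded by a fixed polynomial in $|x|$, for every oracle and every outcome of all coins; reading an oracle answer is charged by the number of bits read. In $R^{\mathcal A}$, every oracle query is answered by $\mathcal A$ with fresh randomness. **Protocols.** Let $\mathcal L\in\mathsf{NP}$ with NP relation $\mathcal R_{\mathcal L}$. A public-coin protocol has $k=k(n)$ rounds on inputs $x\in\{0,1\}^n$. In round $i$ a uniformly random string $r_i$ of a length $m_i(n)$ is sent to the prover, who answers with $\pi_i$, sampled as a function of $x$, (for the honest prover) a witness $w$, and $r_1,\pi_1,\dots,r_i$; honest messages are polynomially long. At the end a deterministic polynomial-time verifier accepts or rejects $(x;r_1,\pi_1,\dots,r_k,\pi_k)$; $(m_i(n))_{i\le k(n)}$,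 in unary, is computable in time polynomial in $n$. The protocol has $t(n)$ messages, where $t(n)=2k(n)$, or $t(n)=2k(n)-1$ if $m_1(n)=0$ (the prover moves first). For $\epsilon_c,\epsilon_s,\epsilon_z:\mathbb N\to[0,1]$ it is an $(\epsilon_c,\epsilon_s,\epsilon_z)$-ZK *proof* for $\mathcal L$ if: * (completeness) for all $(x,w)\in\mathcal R_{\mathcal L}$ with $|x|=n$, the verifier accepts in the interaction with the honest prover with probability at least $1-\epsilon_c(n)$; * (soundness) for every $x\in\{0,1\}^n\setminus\mathcal L_n$ and every prover $\mathsf P^*$, the verifier accepts with probability at most $\epsilon_s(n)$; * (computational zero-knowledge) there is a PPT simulator $\mathsf{Sim}$ such that for every non-uniform PPT distinguisher $D$, all large enough $n$, and all $(x,w)\in\mathcal R_{\mathcal L}$ with $|x|=n$, the distinguishing advantage of $D$ between $\mathsf{Sim}(x)$ and the transcript of the honest interaction on $(x,w)$ is at most $\epsilon_z(n)$. It is an $(\epsilon_c,\epsilon_s,\epsilon_z)$-ZK *argument* if the honest prover is PPT and soundness is only required against PPT provers $\mathsf P^*$ with polynomially long messages (for each such $\mathsf P^*$, for all large enough $n$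 and all $x\in\{0,1\}^n\setminus\mathcal L_n$). **Lemma.** Let $\epsilon_c,\epsilon_s,\epsilon_z:\mathbb N\to[0,1]$ and $t:\mathbb N\to\mathbb N$ with $t(n)\ge 2$ for all $n$. Suppose that a language $\mathcal L\in\mathsf{NP}$ has an $(\epsilon_c,\epsilon_s,\epsilon_z)$-public-coin ZK proof or argument with $t$ messages. Then there exist a polynomial-time oracle-aided algorithm $R$, polynomials $m_1',m_2'$ and a polynomial-time computable function family $\mathcal F=\{f_x:\{0,1\}^{m_1'(|x|)}\to\{0,1\}^{m_2'(|x|)}\}_{x\in\{0,1\}^*}$ such that for every PPT algorithm $\mathcal A$, every polynomial $p$, and all large enough $n\in\mathbb N$: 1. For every $x\in\mathcal L_n$, if $\mathcal A$ distributionally inverts $f_x$ with deviation at most $1/p(n)$, i.e. $\Delta_s\big((u,f_x(u));(\mathcal A(x,f_x(u)),f_x(u))\big)\le 1/p(n)$ for $u\gets\mathcal U_{m_1'(n)}$, then $$\Pr[R^{\mathcal A}(x)=1]\ \ge\ 1-\epsilon_c(n)-(t(n)-1)\,\epsilon_z(n)-\frac{t(n)}{p(n)}.$$ 2. For every $x\in\{0,1\}^n\setminus\mathcal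 L_n$, $\Pr[R^{\mathcal A}(x)=1]\le\epsilon_s(n)$. -/

import Mathlib

namespace PublicCoinZK

/-! ### Machine model: while programs over finite binary trees, with a step count -/

/-- The data of the machine model: finite binary trees whose leaves carry a bit. -/
inductive Val : Type
  | atom (b : Bool)
  | node (l r : Val)

namespace Val

/-- Number of vertices. -/
def size : Val → ℕ
  | atom _ => 1
  | node l r => l.size + r.size + 1

/-- Left component (an atom is left unchanged). -/
def fst : Val → Val
  | atom b => atom b
  | node l _ => l

/-- Right component (an atom is left unchanged). -/
def snd : Val → Val
  | atom b => atom b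
  | node _ r => r

/-- Is the value the atom `true`? -/
def isTrue : Val → Bool
  | atom b => b
  | node _ _ => false

/-- Is the value a node? -/
def isNode : Val → Bool
  | atom _ => false
  | node _ _ => true

/-- Read a value as a bit string: the left components along the right spine. On the encoding of a
bit string (see `HasVal` below) this returns that string. -/
def toBits : Val → List Bool
  | atom _ => []
  | node l r => l.isTrue :: r.toBits

end Val

/-- Types whose elements are written down as trees. -/
class HasVal (α : Type) where
  enc : α → Val

/-- The tree encoding a list. -/
def encList {α : Type} [HasVal α] : List α → Val
  | [] => .atom false
  | a :: l => .node (HasVal.enc a) (encList l)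

instance : HasVal Bool := ⟨Val.atom⟩

instance {α : Type} [HasVal α] : HasVal (List α) := ⟨encList⟩

instance {α β : Type} [HasVal α] [HasVal β] : HasVal (α × β) :=
  ⟨fun a => .node (HasVal.enc a.1) (HasVal.enc a.2)⟩

/-- Size of the encoding of `a`, the input size in which running times are measured. A bit string
of length `n` has size `2 * n + 1`. -/
def inputSize {α : Type} [HasVal α] (a : α) : ℕ := (HasVal.enc a).size

/-- Programs. A program transforms a value; `while t c` repeats `c` as long as the test `t` returns
`true` on the current value, and `ask` is the oracle instruction. -/
inductive Code : Type
  | const (b : Bool)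
  | id
  | fst
  | snd
  | isNode
  | pair (c d : Code)
  | seq (c d : Code)
  | ite (t c d : Code)
  | while (t c : Code)
  | ask

/-- An oracle takes a query consisting of two strings and answers with a string, in a monad `m`
(`m = PMF` for randomized oracles, which answer each query with fresh randomness). -/
abbrev Oracle (m : Type → Type) : Type := List Bool × List Bool → m (List Bool)

/-- At most `N` iterations of a while loop with test `t` and body `c`, where `t` and `c` return
their result together with the number of steps they took. -/
def whileLoop {m : Type → Type} [Monad m] (t c : Val → m (Val × ℕ)) : ℕ → Val → m (Val × ℕ)
  | 0, v => pure (v, v.size + 1)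
  | N + 1, v => do
    let b ← t v
    if b.1.isTrue then
      let u ← c v
      let w ← whileLoop t c N u.1
      pure (w.1, b.2 + u.2 + w.2)
    else
      pure (v, b.2 + v.size + 1)

/-- `c.run O N v` is the result of the program `c` on the value `v` with the oracle `O`, together
with the number of steps taken. Every elementary operation is charged the size of the data that it
handles. The number `N` is a time budget: loops are cut off after `N` iterations. Every iteration
takes at least two steps, so a run in which a loop was cut off reports more than `N` steps, and a
run that reports at most `N` steps was not cut off: it is the complete run of the program.

The operand of `ask` is a triple `(bound, (y, z))`. The query `(y, z)` is sent to the oracle and the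
answer is read up to the length of the string `bound`, so that the program pays for the part of the
answer that it reads. -/
def Code.run {m : Type → Type} [Monad m] (O : Oracle m) (N : ℕ) : Code → Val → m (Val × ℕ)
  | .const b, v => pure (.atom b, v.size + 1)
  | .id, v => pure (v, v.size + 1)
  | .fst, v => pure (v.fst, v.size + 1)
  | .snd, v => pure (v.snd, v.size + 1)
  | .isNode, v => pure (.atom v.isNode, v.size + 1)
  | .pair c d, v => do
    let a ← c.run O N v
    let b ← d.run O N v
    pure (.node a.1 b.1, a.2 + b.2 + v.size + 1)
  | .seq c d, v => do
    let a ← c.run O N v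
    let b ← d.run O N a.1
    pure (b.1, a.2 + b.2 + 1)
  | .ite t c d, v => do
    let b ← t.run O N v
    let u ← if b.1.isTrue then c.run O N v else d.run O N v
    pure (u.1, b.2 + u.2 + v.size + 1)
  | .while t c, v => whileLoop (t.run O N) (c.run O N) N v
  | .ask, v => do
    let a ← O (v.snd.fst.toBits, v.snd.snd.toBits)
    let u : Val := HasVal.enc (a.take v.fst.toBits.length)
    pure (u, v.size + u.size + 1)

/-- The program contains no oracle instruction. -/
def Code.OracleFree : Code → Prop
  | .ask => False
  | .pair c d => c.OracleFree ∧ d.OracleFree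
  | .seq c d => c.OracleFree ∧ d.OracleFree
  | .ite t c d => t.OracleFree ∧ c.OracleFree ∧ d.OracleFree
  | .while t c => t.OracleFree ∧ c.OracleFree
  | _ => True

/-! ### Polynomial-time, probabilistic polynomial-time and oracle-aided algorithms -/

/-- `f` is computed by a deterministic program (without oracle) in a number of steps that is
polynomial in the size of the input. -/
def PolyTime {α β : Type} [HasVal α] [HasVal β] (f : α → β) : Prop :=
  ∃ (c : Code) (p : Polynomial ℕ), c.OracleFree ∧ ∀ a : α,
    let r : Val × ℕ :=
      Id.run (c.run (m := Id) (fun _ => pure []) (p.eval (inputSize a)) (HasVal.enc a))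
    r.1 = HasVal.enc (f a) ∧ r.2 ≤ p.eval (inputSize a)

/-- The uniform distribution on the bit strings of length `n`. -/
noncomputable def unif (n : ℕ) : PMF (List Bool) :=
  (PMF.uniformOfFintype (Fin n → Bool)).map List.ofFn

/-- `A` is a probabilistic polynomial-time algorithm: its output on `a` is computed in
deterministic polynomial time from `a` and polynomially many uniform coins. -/
def PPT {α β : Type} [HasVal α] [HasVal β] (A : α → PMF β) : Prop :=
  ∃ (h : α × List Bool → β) (q : Polynomial ℕ), PolyTime h ∧
    ∀ a : α, A a = (unif (q.eval (inputSize a))).map fun ρ => h (a, ρ)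

/-- `R` is a (probabilistic) polynomial-time oracle-aided algorithm with one-bit output: one program
takes the input and polynomially many uniform coins and, for every oracle and every outcome of the
coins and of the oracle, stops after a number of steps that is polynomial in the input length. -/
def OraclePolyTime (R : Oracle PMF → List Bool → PMF Bool) : Prop :=
  ∃ (c : Code) (p q : Polynomial ℕ), ∀ (O : Oracle PMF) (x : List Bool),
    (∀ ρ : List Bool, ρ.length = q.eval x.length →
      ∀ o ∈ (c.run O (p.eval x.length) (HasVal.enc (x, ρ))).support, o.2 ≤ p.eval x.length) ∧
    R O x = (unif (q.eval x.length)).bind fun ρ =>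
      (c.run O (p.eval x.length) (HasVal.enc (x, ρ))).map fun o => o.1.isTrue

/-! ### Statistical distance and distributional inversion -/

/-- Statistical distance. -/
noncomputable def statDist {α : Type} (P Q : PMF α) : ℝ :=
  (1 / 2) * ∑' u, |(P u).toReal - (Q u).toReal|

/-- `A` distributionally inverts `f x`, as a function on the strings of length `m`, with deviation
at most `δ`: the distributions `(ρ, f x ρ)` and `(A (x, f x ρ), f x ρ)`, for uniform `ρ`, are at
statistical distance at most `δ`. -/
def DistInverts (A : List Bool × List Bool → PMF (List Bool)) (f : List Bool → List Bool → List Bool)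
    (x : List Bool) (m : ℕ) (δ : ℝ) : Prop :=
  statDist ((unif m).map fun ρ => (ρ, f x ρ))
    ((unif m).bind fun ρ => (A (x, f x ρ)).map fun ρ' => (ρ', f x ρ)) ≤ δ

/-- `f = (f x)` is a polynomial-time computable function family in which `f x` maps strings of
length `m₁ |x|` to strings of length `m₂ |x|`. -/
def IsPolyTimeFamily (f : List Bool → List Bool → List Bool) (m₁ m₂ : Polynomial ℕ) : Prop :=
  PolyTime (fun a : List Bool × List Bool => f a.1 a.2) ∧
  ∀ x ρ : List Bool, ρ.length = m₁.eval x.length → (f x ρ).length = m₂.eval x.length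

/-! ### NP relations and public-coin zero-knowledge protocols -/

/-- `Rel` is an NP relation for the language `L`. -/
def IsNPRelation (L : Language Bool) (Rel : List Bool → List Bool → Prop) : Prop :=
  (∃ d : List Bool × List Bool → Bool, PolyTime d ∧ ∀ x w, Rel x w ↔ d (x, w) = true) ∧
  (∃ b : Polynomial ℕ, ∀ x w, Rel x w → w.length ≤ b.eval x.length) ∧
  ∀ x, x ∈ L ↔ ∃ w, Rel x w

/-- A transcript `(r₁, π₁), …, (rₖ, πₖ)`, possibly partial. -/
abbrev Transcript : Type := List (List Bool × List Bool)

/-- A prover strategy: given the transcript of the previous rounds and the random string of the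
current round, it samples a message. -/
abbrev Strategy : Type := Transcript → List Bool → PMF (List Bool)

/-- A public-coin protocol. On inputs of length `n` it has `(coins n).length` rounds, and the
verifier's random string in a round has the length listed in `coins n`. -/
structure Protocol where
  coins : ℕ → List ℕ
  /-- The honest prover, given the instance and a witness. -/
  prover : List Bool → List Bool → Strategy
  /-- The verifier's decision, given the instance and the full transcript. -/
  verifier : List Bool → Transcript → Bool

/-- Continue the transcript `τ` with rounds whose random strings have the lengths in the list: in
each round a uniform string is sampled and the prover responds. -/
noncomputable def interact (P : Strategy) : List ℕ → Transcript → PMF Transcript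
  | [], τ => PMF.pure τ
  | m :: ms, τ => (unif m).bind fun r => (P τ r).bind fun π => interact P ms (τ ++ [(r, π)])

namespace Protocol

variable (Γ : Protocol)

/-- The transcript of an execution on instance `x` with the prover strategy `P`. -/
noncomputable def view (P : Strategy) (x : List Bool) : PMF Transcript :=
  interact P (Γ.coins x.length) []

/-- The probability that the verifier accepts in an execution with prover strategy `P`. -/
noncomputable def acceptProb (P : Strategy) (x : List Bool) : ℝ :=
  ((Γ.view P x).map (Γ.verifier x) true).toReal

/-- The protocol has `t n` messages on inputs of length `n`: two per round, or one less if the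
prover moves first, in which case the verifier's first message is the empty string. -/
def HasMessages (t : ℕ → ℕ) : Prop :=
  ∀ n, t n = 2 * (Γ.coins n).length ∨
    (t n + 1 = 2 * (Γ.coins n).length ∧ (Γ.coins n).head? = some 0)

/-- The verifier is efficient: the lengths of its random strings (in unary) and its decision are
computable in deterministic polynomial time. -/
def EfficientVerifier : Prop :=
  PolyTime (fun x : List Bool => (Γ.coins x.length).map fun m => List.replicate m true) ∧
  PolyTime (fun a : List Bool × Transcript => Γ.verifier a.1 a.2)

/-- The honest prover's messages are polynomially long. -/
def PolyMessages (Rel : List Bool → List Bool → Prop) : Prop :=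
  ∃ b : Polynomial ℕ, ∀ x w, Rel x w → ∀ τ r, ∀ π ∈ (Γ.prover x w τ r).support,
    π.length ≤ b.eval x.length

/-- Completeness with error `ε`. -/
def Complete (Rel : List Bool → List Bool → Prop) (ε : ℕ → ℝ) : Prop :=
  ∀ x w, Rel x w → 1 - ε x.length ≤ Γ.acceptProb (Γ.prover x w) x

/-- Soundness with error `ε` against all provers. -/
def Sound (L : Language Bool) (ε : ℕ → ℝ) : Prop :=
  ∀ x, x ∉ L → ∀ P : Strategy, Γ.acceptProb P x ≤ ε x.length

/-- Soundness with error `ε` against efficient provers: for every prover that samples its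
(polynomially long) messages in probabilistic polynomial time, the bound holds on all inputs outside
the language that are long enough. -/
def ComputationallySound (L : Language Bool) (ε : ℕ → ℝ) : Prop :=
  ∀ P : List Bool → Strategy,
    PPT (fun a : List Bool × Transcript × List Bool => P a.1 a.2.1 a.2.2) →
    (∃ b : Polynomial ℕ, ∀ x τ r, ∀ π ∈ (P x τ r).support, π.length ≤ b.eval x.length) →
    ∀ᶠ n in Filter.atTop, ∀ x : List Bool, x.length = n → x ∉ L → Γ.acceptProb (P x) x ≤ ε n

/-- Computational zero-knowledge with error `ε`: the output of some probabilistic polynomial-time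
simulator is `ε`-indistinguishable from the view, for non-uniform probabilistic polynomial-time
distinguishers `D` (which are given an advice string `z n` of polynomial length) and all large
enough `n`. -/
def ZeroKnowledge (Rel : List Bool → List Bool → Prop) (ε : ℕ → ℝ) : Prop :=
  ∃ Sim : List Bool → PMF Transcript, PPT Sim ∧
    ∀ D : List Bool × List Bool × Transcript → PMF Bool, PPT D →
    ∀ z : ℕ → List Bool, (∃ b : Polynomial ℕ, ∀ n, (z n).length ≤ b.eval n) →
    ∀ᶠ n in Filter.atTop, ∀ x w : List Bool, x.length = n → Rel x w →
      |(((Sim x).bind fun τ => D (z n, x, τ)) true).toReal -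
        (((Γ.view (Γ.prover x w) x).bind fun τ => D (z n, x, τ)) true).toReal| ≤ ε n

/-- The honest prover runs in probabilistic polynomial time. -/
def EfficientProver : Prop :=
  PPT fun a : (List Bool × List Bool) × Transcript × List Bool =>
    Γ.prover a.1.1 a.1.2 a.2.1 a.2.2

/-- A public-coin `(εc, εs, εz)`-zero-knowledge proof. -/
def IsZKProof (L : Language Bool) (Rel : List Bool → List Bool → Prop) (εc εs εz : ℕ → ℝ) : Prop :=
  Γ.EfficientVerifier ∧ Γ.PolyMessages Rel ∧
    Γ.Complete Rel εc ∧ Γ.Sound L εs ∧ Γ.ZeroKnowledge Rel εz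

/-- A public-coin `(εc, εs, εz)`-zero-knowledge argument. -/
def IsZKArgument (L : Language Bool) (Rel : List Bool → List Bool → Prop) (εc εs εz : ℕ → ℝ) :
    Prop :=
  Γ.EfficientVerifier ∧ Γ.PolyMessages Rel ∧ Γ.EfficientProver ∧
    Γ.Complete Rel εc ∧ Γ.ComputationallySound L εs ∧ Γ.ZeroKnowledge Rel εz

end Protocol

end PublicCoinZK

open PublicCoinZK

/-!
Replace the messages of the honest prover by answers of an inverter for the simulator. The function
`f x` runs the zero-knowledge simulator and outputs a random round `j` of the simulated transcript,
in the form of the first `j` rounds and the next random string of the verifier; it also outputs a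
bit, which in the last round says whether the whole transcript is accepted. A preimage of a partial
transcript is a run of the simulator that continues it, so an inverter of `f x` provides an
efficient prover, and the reduction accepts if the verifier accepts in an interaction with this
cheating prover. Soundness bounds the acceptance probability outside the language.

On the language, compare the executions in which the cheating prover takes over after `j` rounds.
To pass from `j` to `j + 1`, replace the honest transcript by a simulated one, at the cost of `εz`;
there the inverter may choose the next message, since distributional inversion says that this
message has almost the right joint distribution with its past; finally return to the honest
transcript, again at the cost of `εz`. This makes two comparisons for each of the `k` rounds. One of
them is saved in the last round, where the acceptance bit makes a single comparison suffice, and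
another one if the prover moves first, since the first comparison is then perfect: `t - 1` in total.
The round `j` takes `2 ^ ⌈log₂ k⌉ ≤ 2 * k - 1 ≤ t` values, each with the same probability, so that
the losses from the inversion, summed over all rounds, are at most `t * δ`.
-/

namespace PublicCoinZK

/-! ### Big-step semantics of oracle-free computations -/

namespace Val

lemma one_le_size (v : Val) : 1 ≤ v.size := by
  cases v <;> simp [size]

lemma fst_size_le (v : Val) : v.fst.size ≤ v.size := by
  cases v <;> simp only [fst, size] <;> omega

lemma snd_size_le (v : Val) : v.snd.size ≤ v.size := by
  cases v <;> simp only [snd, size] <;> omega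

lemma toBits_enc (l : List Bool) : (HasVal.enc l : Val).toBits = l := by
  induction l with
  | nil => rfl
  | cons b l ih => exact congrArg (b :: ·) ih

end Val

/-- Big-step semantics: `Eval c v u s` means that the program `c`, without using the oracle,
transforms `v` into `u` in `s` steps. Unlike `Code.run` it has no time budget, so that running
times need not be known before the computation has been described. -/
inductive Eval : Code → Val → Val → ℕ → Prop
  | const (b : Bool) (v : Val) : Eval (.const b) v (.atom b) (v.size + 1)
  | id (v : Val) : Eval .id v v (v.size + 1)
  | fst (v : Val) : Eval .fst v v.fst (v.size + 1)
  | snd (v : Val) : Eval .snd v v.snd (v.size + 1)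
  | isNode (v : Val) : Eval .isNode v (.atom v.isNode) (v.size + 1)
  | pair {c d : Code} {v a b : Val} {s s' : ℕ} : Eval c v a s → Eval d v b s' →
      Eval (.pair c d) v (.node a b) (s + s' + v.size + 1)
  | seq {c d : Code} {v a b : Val} {s s' : ℕ} : Eval c v a s → Eval d a b s' →
      Eval (.seq c d) v b (s + s' + 1)
  | ite_true {t c d : Code} {v b u : Val} {s s' : ℕ} : Eval t v b s → b.isTrue = true →
      Eval c v u s' → Eval (.ite t c d) v u (s + s' + v.size + 1)
  | ite_false {t c d : Code} {v b u : Val} {s s' : ℕ} : Eval t v b s → b.isTrue = false →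
      Eval d v u s' → Eval (.ite t c d) v u (s + s' + v.size + 1)
  | while_true {t c : Code} {v b u w : Val} {s s' s'' : ℕ} : Eval t v b s → b.isTrue = true →
      Eval c v u s' → Eval (.while t c) u w s'' → Eval (.while t c) v w (s + s' + s'')
  | while_false {t c : Code} {v b : Val} {s : ℕ} : Eval t v b s → b.isTrue = false →
      Eval (.while t c) v v (s + v.size + 1)

namespace Eval

lemma size_le {c : Code} {v u : Val} {s : ℕ} (h : Eval c v u s) : u.size ≤ s := by
  induction h with
  | const | isNode => simp [Val.size]
  | fst v => exact v.fst_size_le.trans (Nat.le_succ _)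
  | snd v => exact v.snd_size_le.trans (Nat.le_succ _)
  | pair => simp only [Val.size]; omega
  | _ => omega

lemma one_le {c : Code} {v u : Val} {s : ℕ} (h : Eval c v u s) : 1 ≤ s :=
  u.one_le_size.trans h.size_le

section Monad

variable {m : Type → Type} [Monad m] [LawfulMonad m] (O : Oracle m)

/-- The second component generalizes the number of iterations of the outermost loop, which
`Code.run` ties to the time budget of the subprograms. -/
lemma run_and_whileLoop {c : Code} {v u : Val} {s N : ℕ} (h : Eval c v u s) (hN : s ≤ N) :
    c.run O N v = pure (u, s) ∧ ∀ t d, c = .while t d → ∀ M, s ≤ M →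
      whileLoop (t.run O N) (d.run O N) M v = pure (u, s) := by
  induction h with
  | const | id | fst | snd | isNode => simp [Code.run]
  | pair _ _ ihc ihd | seq _ _ ihc ihd =>
    simp [Code.run, (ihc (by omega)).1, (ihd (by omega)).1]
  | ite_true _ hb _ iht ihc | ite_false _ hb _ iht ihc =>
    simp [Code.run, (iht (by omega)).1, (ihc (by omega)).1, hb]
  | @while_true t c v b u w s s' s'' ht hb _ _ iht ihc ihw =>
    have key : ∀ M, s + s' + s'' ≤ M →
        whileLoop (t.run O N) (c.run O N) M v = pure (w, s + s' + s'')
      | 0, hM => by have := ht.one_le; omega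
      | M + 1, hM => by
        have := ht.one_le
        simp [whileLoop, (iht (by omega)).1, (ihc (by omega)).1, hb,
          (ihw (by omega)).2 t c rfl M (by omega)]
    exact ⟨key N hN, by rintro _ _ ⟨⟩; exact key⟩
  | @while_false t c v b s _ hb iht =>
    have key : ∀ M, s + v.size + 1 ≤ M →
        whileLoop (t.run O N) (c.run O N) M v = pure (v, s + v.size + 1)
      | M + 1, _ => by simp [whileLoop, (iht (by omega)).1, hb]
    exact ⟨key N hN, by rintro _ _ ⟨⟩; exact key⟩

lemma run {c : Code} {v u : Val} {s N : ℕ} (h : Eval c v u s) (hN : s ≤ N) :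
    c.run O N v = pure (u, s) :=
  (h.run_and_whileLoop O hN).1

end Monad

lemma of_whileLoop {t c : Code} {T C : Val → Id (Val × ℕ)} {N : ℕ}
    (hT : ∀ v, (T v).2 ≤ N → Eval t v (T v).1 (T v).2)
    (hC : ∀ v, (C v).2 ≤ N → Eval c v (C v).1 (C v).2) (M : ℕ) (v : Val)
    (hN : (whileLoop T C M v).2 ≤ N) (hM : (whileLoop T C M v).2 ≤ M) :
    Eval (.while t c) v (whileLoop T C M v).1 (whileLoop T C M v).2 := by
  induction M generalizing v with
  | zero => exact absurd hM (Nat.not_succ_le_zero _)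
  | succ M ih =>
    have hloop : whileLoop T C (M + 1) v = if (T v).1.isTrue then
        ((whileLoop T C M (C v).1).1, (T v).2 + (C v).2 + (whileLoop T C M (C v).1).2)
        else (v, (T v).2 + v.size + 1) := rfl
    rw [hloop] at hN hM ⊢
    rcases hb : (T v).1.isTrue with _ | _
    · simp only [hb, Bool.false_eq_true, if_false] at hN hM ⊢
      exact .while_false (hT v (by omega)) hb
    · simp only [hb, if_true] at hN hM ⊢
      have ht := hT v (by omega)
      have := ht.one_le
      exact .while_true ht hb (hC v (by omega)) (ih _ (by omega) (by omega))

lemma of_run (O : Oracle Id) (N : ℕ) {c : Code} (hc : c.OracleFree) (v : Val)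
    (hN : (c.run O N v).2 ≤ N) : Eval c v (c.run O N v).1 (c.run O N v).2 := by
  induction c generalizing v with
  | const b => exact .const b v
  | id => exact .id v
  | fst => exact .fst v
  | snd => exact .snd v
  | isNode => exact .isNode v
  | pair c d ihc ihd =>
    have hle : (c.run O N v).2 + (d.run O N v).2 + v.size + 1 ≤ N := hN
    exact .pair (ihc hc.1 v (by omega)) (ihd hc.2 v (by omega))
  | seq c d ihc ihd =>
    have hle : (c.run O N v).2 + (d.run O N (c.run O N v).1).2 + 1 ≤ N := hN
    exact .seq (ihc hc.1 v (by omega)) (ihd hc.2 _ (by omega))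
  | ite t c d iht ihc ihd =>
    have hrun : (Code.ite t c d).run O N v =
        if (t.run O N v).1.isTrue then
          ((c.run O N v).1, (t.run O N v).2 + (c.run O N v).2 + v.size + 1)
        else ((d.run O N v).1, (t.run O N v).2 + (d.run O N v).2 + v.size + 1) := rfl
    rw [hrun] at hN ⊢
    rcases hb : (t.run O N v).1.isTrue with _ | _
    · simp only [hb, Bool.false_eq_true, if_false] at hN ⊢
      exact .ite_false (iht hc.1 v (by omega)) hb (ihd hc.2.2 v (by omega))
    · simp only [hb, if_true] at hN ⊢
      exact .ite_true (iht hc.1 v (by omega)) hb (ihc hc.2.1 v (by omega))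
  | ask => exact hc.elim
  | _ t c iht ihc => exact of_whileLoop (iht hc.1) (ihc hc.2) N v hN hN

end Eval

/-! ### Closure properties of polynomial-time functions -/

@[gcongr]
lemma polynomial_eval_le_eval {R : Type*} [CommSemiring R] [PartialOrder R] [IsOrderedRing R]
    [CanonicallyOrderedAdd R] (p : Polynomial R) {a b : R} (h : a ≤ b) : p.eval a ≤ p.eval b := by
  simp only [Polynomial.eval_eq_sum, Polynomial.sum]
  gcongr

lemma Eval.while_iterate {t c : Code} {n T C : ℕ} {g : ℕ → Val}
    (ht : ∀ i ≤ n, ∃ s ≤ T, Eval t (g i) (.atom (decide (i < n))) s)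
    (hc : ∀ i < n, ∃ s ≤ C, Eval c (g i) (g (i + 1)) s) :
    ∃ s ≤ n * (T + C) + (T + (g n).size + 1), Eval (.while t c) (g 0) (g n) s := by
  induction n generalizing g with
  | zero =>
    obtain ⟨s, hs, he⟩ := ht 0 le_rfl
    exact ⟨_, by omega, .while_false he rfl⟩
  | succ n ih =>
    obtain ⟨s, hs, he⟩ := ht 0 (Nat.zero_le _)
    obtain ⟨s', hs', he'⟩ := hc 0 (Nat.succ_pos n)
    obtain ⟨s'', hs'', he''⟩ := ih (g := fun i => g (i + 1))
      (fun i hi => by simpa using ht (i + 1) (by omega)) (fun i hi => hc (i + 1) (by omega))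
    exact ⟨_, by rw [add_mul, one_mul]; omega, .while_true he rfl he' he''⟩

section

variable {α β γ σ : Type} [HasVal α] [HasVal β] [HasVal γ] [HasVal σ]

lemma one_le_inputSize (a : α) : 1 ≤ inputSize a := Val.one_le_size _

lemma inputSize_pair (a : α) (b : β) : inputSize (a, b) = inputSize a + inputSize b + 1 := rfl

lemma inputSize_nil : inputSize ([] : List α) = 1 := rfl

lemma inputSize_cons (a : α) (l : List α) :
    inputSize (a :: l) = inputSize a + inputSize l + 1 := rfl

attribute [fun_prop] PolyTime

theorem polyTime_iff {f : α → β} : PolyTime f ↔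
    ∃ (c : Code) (p : Polynomial ℕ), c.OracleFree ∧ ∀ a : α,
      ∃ s ≤ p.eval (inputSize a), Eval c (HasVal.enc a) (HasVal.enc (f a)) s := by
  refine exists₂_congr fun c p => and_congr_right fun hc => forall_congr' fun a => ⟨?_, ?_⟩
  · rintro ⟨hval, hle⟩
    exact ⟨_, hle, hval ▸ Eval.of_run _ _ hc (HasVal.enc a) hle⟩
  · rintro ⟨s, hs, he⟩
    simp only [he.run (m := Id) (fun _ => pure []) hs]
    exact ⟨rfl, hs⟩

namespace PolyTime

lemma exists_inputSize_le {f : α → β} (hf : PolyTime f) :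
    ∃ p : Polynomial ℕ, ∀ a, inputSize (f a) ≤ p.eval (inputSize a) := by
  obtain ⟨c, p, -, h⟩ := polyTime_iff.1 hf
  refine ⟨p, fun a => ?_⟩
  obtain ⟨s, hs, he⟩ := h a
  exact he.size_le.trans hs

lemma congr {f g : α → β} (hf : PolyTime f) (h : ∀ a, f a = g a) : PolyTime g :=
  funext h ▸ hf

lemma of_enc_eq {α' β' : Type} [HasVal α'] [HasVal β'] {f : α → β} {g : α' → β'}
    (hf : PolyTime f) (φ : α' → α) (hφ : ∀ a, HasVal.enc (φ a) = HasVal.enc a)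
    (h : ∀ a, HasVal.enc (f (φ a)) = HasVal.enc (g a)) : PolyTime g := by
  obtain ⟨c, p, hc, hf⟩ := polyTime_iff.1 hf
  refine polyTime_iff.2 ⟨c, p, hc, fun a => ?_⟩
  simpa only [inputSize, hφ, h] using hf (φ a)

@[fun_prop]
protected lemma id : PolyTime fun a : α => a :=
  polyTime_iff.2 ⟨.id, .X + 1, trivial, fun a => ⟨_, by simp [inputSize], .id _⟩⟩

@[fun_prop]
lemma comp {g : β → γ} {f : α → β} (hg : PolyTime g) (hf : PolyTime f) :
    PolyTime fun a => g (f a) := by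
  obtain ⟨c, p, hc, h⟩ := polyTime_iff.1 hf
  obtain ⟨d, q, hd, h'⟩ := polyTime_iff.1 hg
  refine polyTime_iff.2 ⟨.seq c d, p + q.comp p + 1, ⟨hc, hd⟩, fun a => ?_⟩
  obtain ⟨s, hs, he⟩ := h a
  obtain ⟨s', hs', he'⟩ := h' (f a)
  have hq : q.eval (inputSize (f a)) ≤ q.eval (p.eval (inputSize a)) :=
    polynomial_eval_le_eval q (he.size_le.trans hs)
  refine ⟨_, ?_, .seq he he'⟩
  simp only [Polynomial.eval_add, Polynomial.eval_comp, Polynomial.eval_one]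
  omega

@[fun_prop]
lemma fst {f : α → β × γ} (hf : PolyTime f) : PolyTime fun a => (f a).1 :=
  have hfst : PolyTime fun a : β × γ => a.1 :=
    polyTime_iff.2 ⟨.fst, .X + 1, trivial, fun a => ⟨_, by simp [inputSize], .fst _⟩⟩
  hfst.comp hf

@[fun_prop]
lemma snd {f : α → β × γ} (hf : PolyTime f) : PolyTime fun a => (f a).2 :=
  have hsnd : PolyTime fun a : β × γ => a.2 :=
    polyTime_iff.2 ⟨.snd, .X + 1, trivial, fun a => ⟨_, by simp [inputSize], .snd _⟩⟩
  hsnd.comp hf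

@[fun_prop]
lemma prodMk {f : α → β} {g : α → γ} (hf : PolyTime f) (hg : PolyTime g) :
    PolyTime fun a => (f a, g a) := by
  obtain ⟨c, p, hc, h⟩ := polyTime_iff.1 hf
  obtain ⟨d, q, hd, h'⟩ := polyTime_iff.1 hg
  refine polyTime_iff.2 ⟨.pair c d, p + q + .X + 1, ⟨hc, hd⟩, fun a => ?_⟩
  obtain ⟨s, hs, he⟩ := h a
  obtain ⟨s', hs', he'⟩ := h' a
  refine ⟨_, ?_, .pair he he'⟩
  simp only [Polynomial.eval_add, Polynomial.eval_one, Polynomial.eval_X, inputSize] at *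
  omega

@[fun_prop]
lemma ite {b : α → Bool} {f g : α → β} (hb : PolyTime b) (hf : PolyTime f) (hg : PolyTime g) :
    PolyTime fun a => if b a = true then f a else g a := by
  obtain ⟨t, p, ht, h⟩ := polyTime_iff.1 hb
  obtain ⟨c, q, hc, h'⟩ := polyTime_iff.1 hf
  obtain ⟨d, r, hd, h''⟩ := polyTime_iff.1 hg
  refine polyTime_iff.2 ⟨.ite t c d, p + q + r + .X + 1, ⟨ht, hc, hd⟩, fun a => ?_⟩
  obtain ⟨s, hs, he⟩ := h a
  obtain ⟨s', hs', he'⟩ := h' a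
  obtain ⟨s'', hs'', he''⟩ := h'' a
  simp only [Polynomial.eval_add, Polynomial.eval_one, Polynomial.eval_X, inputSize] at *
  rcases hba : b a with _ | _ <;> rw [hba] at he
  · exact ⟨_, by omega, .ite_false he rfl he''⟩
  · exact ⟨_, by omega, .ite_true he rfl he'⟩

lemma exists_eval_eq (v : Val) : ∃ (c : Code) (p : Polynomial ℕ), c.OracleFree ∧
    ∀ u : Val, ∃ s ≤ p.eval u.size, Eval c u v s := by
  induction v with
  | atom b => exact ⟨.const b, .X + 1, trivial, fun u => ⟨_, by simp, .const b u⟩⟩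
  | node l r hl hr =>
    obtain ⟨c, p, hc, hp⟩ := hl
    obtain ⟨d, q, hd, hq⟩ := hr
    refine ⟨.pair c d, p + q + .X + 1, ⟨hc, hd⟩, fun u => ?_⟩
    obtain ⟨s, hs, he⟩ := hp u
    obtain ⟨s', hs', he'⟩ := hq u
    refine ⟨_, ?_, .pair he he'⟩
    simp only [Polynomial.eval_add, Polynomial.eval_one, Polynomial.eval_X]
    omega

@[fun_prop]
protected lemma const (b : β) : PolyTime fun _ : α => b := by
  obtain ⟨c, p, hc, hp⟩ := exists_eval_eq (HasVal.enc b)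
  exact polyTime_iff.2 ⟨c, p, hc, fun a => hp _⟩

@[fun_prop]
lemma not {f : α → Bool} (hf : PolyTime f) : PolyTime fun a => !f a :=
  (hf.ite (.const false) (.const true)).congr fun a => by cases f a <;> rfl

@[fun_prop]
lemma or {f g : α → Bool} (hf : PolyTime f) (hg : PolyTime g) : PolyTime fun a => f a || g a :=
  (hf.ite (.const true) hg).congr fun a => by cases f a <;> rfl

@[fun_prop]
lemma and {f g : α → Bool} (hf : PolyTime f) (hg : PolyTime g) : PolyTime fun a => f a && g a :=
  (hf.ite hg (.const false)).congr fun a => by cases f a <;> rfl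

lemma iterate_while {init : γ → σ} {test : σ → Bool} {step : σ → σ} (hi : PolyTime init)
    (ht : PolyTime test) (hs : PolyTime step) (n : γ → ℕ) (T B : Polynomial ℕ)
    (hn : ∀ c, n c ≤ T.eval (inputSize c))
    (htest : ∀ c, ∀ i ≤ n c, test (step^[i] (init c)) = decide (i < n c))
    (hB : ∀ c, ∀ i ≤ n c, inputSize (step^[i] (init c)) ≤ B.eval (inputSize c)) :
    PolyTime fun c => step^[n c] (init c) := by
  obtain ⟨e, r, hef, he⟩ := polyTime_iff.1 hi
  obtain ⟨t, p, htf, ht⟩ := polyTime_iff.1 ht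
  obtain ⟨d, q, hdf, hd⟩ := polyTime_iff.1 hs
  refine polyTime_iff.2 ⟨.seq e (.while t d),
    r + (T * (p.comp B + q.comp B) + (p.comp B + B + 1)) + 1, ⟨hef, htf, hdf⟩, fun c => ?_⟩
  set S := B.eval (inputSize c) with hS
  obtain ⟨a, ha, hinit⟩ := he c
  obtain ⟨b, hb, hloop⟩ := Eval.while_iterate (t := t) (c := d) (n := n c) (T := p.eval S)
    (C := q.eval S) (g := fun i => HasVal.enc (step^[i] (init c)))
    (fun i hi => by
      obtain ⟨s, hs, h⟩ := ht (step^[i] (init c))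
      exact ⟨s, hs.trans (polynomial_eval_le_eval p (hB c i hi)), htest c i hi ▸ h⟩)
    (fun i hi => by
      obtain ⟨s, hs, h⟩ := hd (step^[i] (init c))
      rw [Function.iterate_succ_apply']
      exact ⟨s, hs.trans (polynomial_eval_le_eval q (hB c i hi.le)), h⟩)
  have hsize : (HasVal.enc (step^[n c] (init c))).size ≤ S := hB c _ le_rfl
  have hiter := Nat.mul_le_mul_right (p.eval S + q.eval S) (hn c)
  refine ⟨_, ?_, .seq hinit hloop⟩
  simp only [Polynomial.eval_add, Polynomial.eval_mul, Polynomial.eval_comp, Polynomial.eval_one,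
    ← hS]
  omega

end PolyTime

/-! ### Lists and unary numbers -/

/-- Natural numbers are written in unary. -/
instance : HasVal ℕ := ⟨fun n => HasVal.enc (List.replicate n true)⟩

/-- A tree encodes itself. -/
instance : HasVal Val := ⟨fun v => v⟩

lemma inputSize_bits (l : List Bool) : inputSize l = 2 * l.length + 1 := by
  induction l with
  | nil => rfl
  | cons b l ih => rw [inputSize_cons, show inputSize b = 1 from rfl, ih, List.length_cons]; ring

lemma inputSize_nat (n : ℕ) : inputSize n = 2 * n + 1 := by
  have h := inputSize_bits (List.replicate n true)
  rwa [List.length_replicate] at h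

lemma length_le_inputSize (l : List α) : l.length ≤ inputSize l := by
  induction l with
  | nil => exact Nat.zero_le _
  | cons a l ih => rw [inputSize_cons, List.length_cons]; omega

lemma inputSize_append (l l' : List α) :
    inputSize (l ++ l') + 1 = inputSize l + inputSize l' := by
  induction l with
  | nil => rw [List.nil_append, inputSize_nil, add_comm]
  | cons a l ih => rw [List.cons_append, inputSize_cons, inputSize_cons]; omega

lemma inputSize_reverse (l : List α) : inputSize l.reverse = inputSize l := by
  induction l with
  | nil => rfl
  | cons a l ih =>
    have h := inputSize_append l.reverse [a]
    rw [inputSize_cons a [], inputSize_nil] at h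
    rw [List.reverse_cons, inputSize_cons]
    omega

lemma inputSize_le_of_prefix {l l' : List α} (h : l <+: l') : inputSize l ≤ inputSize l' := by
  obtain ⟨m, rfl⟩ := h
  have := inputSize_append l m
  have := one_le_inputSize m
  omega

lemma inputSize_le_of_suffix {l l' : List α} (h : l <:+ l') : inputSize l ≤ inputSize l' := by
  simpa only [inputSize_reverse] using inputSize_le_of_prefix (List.reverse_prefix.2 h)

lemma inputSize_le_of_mem {a : α} {l : List α} (h : a ∈ l) : inputSize a ≤ inputSize l := by
  obtain ⟨m, m', rfl⟩ := List.append_of_mem h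
  have h' := inputSize_append m (a :: m')
  have := one_le_inputSize m
  rw [inputSize_cons] at h'
  omega

lemma inputSize_le_of_forall {l : List α} {M : ℕ} (h : ∀ a ∈ l, inputSize a ≤ M) :
    inputSize l ≤ l.length * (M + 1) + 1 := by
  induction l with
  | nil => simp [inputSize_nil]
  | cons a l ih =>
    have ha := h a List.mem_cons_self
    have hl := ih fun b hb => h b (List.mem_cons_of_mem a hb)
    rw [inputSize_cons, List.length_cons, add_mul, one_mul]
    omega

lemma inputSize_flatten_le (l : List (List α)) : inputSize l.flatten ≤ inputSize l := by
  induction l with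
  | nil => exact le_rfl
  | cons a l ih =>
    have := inputSize_append a l.flatten
    rw [List.flatten_cons, inputSize_cons]
    omega

namespace PolyTime

@[fun_prop]
lemma cons {f : γ → α} {g : γ → List α} (hf : PolyTime f) (hg : PolyTime g) :
    PolyTime fun c => f c :: g c :=
  (hf.prodMk hg).of_enc_eq (fun c => c) (fun _ => rfl) fun _ => rfl

@[fun_prop]
lemma listCasesOn {f : γ → List α} {g : γ → β} {h : γ → α → List α → β} (hf : PolyTime f)
    (hg : PolyTime g) (hh : PolyTime fun a : γ × α × List α => h a.1 a.2.1 a.2.2) :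
    PolyTime fun c => List.casesOn (motive := fun _ => β) (f c) (g c) (h c) := by
  obtain ⟨e, p, hef, he⟩ := polyTime_iff.1 hf
  obtain ⟨d, q, hdf, hd⟩ := polyTime_iff.1 hg
  obtain ⟨k, r, hkf, hk⟩ := polyTime_iff.1 hh
  refine polyTime_iff.2 ⟨.ite (.seq e .isNode) (.seq (.pair .id e) k) d,
    4 * p + q + r.comp (.X + p + 1) + 4 * .X + 10,
    ⟨⟨hef, trivial⟩, ⟨⟨trivial, hef⟩, hkf⟩, hdf⟩, fun c => ?_⟩
  obtain ⟨s, hs, hse⟩ := he c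
  have htest := Eval.seq hse (.isNode _)
  have hsize := hse.size_le
  simp only [Polynomial.eval_add, Polynomial.eval_mul, Polynomial.eval_comp, Polynomial.eval_one,
    Polynomial.eval_X, Polynomial.eval_ofNat]
  rcases hfc : f c with _ | ⟨a, l⟩ <;> rw [hfc] at hse htest hsize
  · obtain ⟨s', hs', hse'⟩ := hd c
    refine ⟨_, ?_, .ite_false htest rfl hse'⟩
    simp only [inputSize] at *
    omega
  · obtain ⟨s', hs', hse'⟩ := hk (c, a, l)
    have hr : r.eval (inputSize (c, a, l)) ≤ r.eval (inputSize c + p.eval (inputSize c) + 1) :=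
      polynomial_eval_le_eval r <|
        Nat.succ_le_succ (Nat.add_le_add_left (hsize.trans hs) (inputSize c))
    refine ⟨_, ?_, .ite_true htest rfl (.seq (.pair (.id _) hse) hse')⟩
    simp only [inputSize] at *
    omega

@[fun_prop]
lemma isEmpty {f : γ → List α} (hf : PolyTime f) : PolyTime fun c => (f c).isEmpty :=
  (hf.listCasesOn (h := fun _ _ _ => false) (.const true) (.const false)).congr fun c => by
    cases f c <;> rfl

@[fun_prop]
lemma tail {f : γ → List α} (hf : PolyTime f) : PolyTime fun c => (f c).tail :=
  (hf.listCasesOn (h := fun _ _ l => l) (.const []) (by fun_prop)).congr fun c => by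
    cases f c <;> rfl

@[fun_prop]
lemma headD {f : γ → List α} {g : γ → α} (hf : PolyTime f) (hg : PolyTime g) :
    PolyTime fun c => (f c).headD (g c) :=
  (hf.listCasesOn (h := fun _ a _ => a) hg (by fun_prop)).congr fun c => by
    cases f c <;> rfl

lemma foldl {l : γ → List α} {s : γ → σ} {g : γ → σ → α → σ} (hl : PolyTime l)
    (hs : PolyTime s) (hg : PolyTime fun a : γ × σ × α => g a.1 a.2.1 a.2.2) (B : Polynomial ℕ)
    (hB : ∀ c l', l' <+: l c → inputSize (l'.foldl (g c) (s c)) ≤ B.eval (inputSize c)) :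
    PolyTime fun c => (l c).foldl (g c) (s c) := by
  let step : γ × σ × List α → γ × σ × List α := fun a =>
    List.casesOn (motive := fun _ => γ × σ × List α) a.2.2 a fun b l => (a.1, g a.1 a.2.1 b, l)
  have hstep : PolyTime step := by fun_prop
  have hiter (c : γ) (s : σ) (l : List α) (i : ℕ) :
      step^[i] (c, s, l) = (c, (l.take i).foldl (g c) s, l.drop i) := by
    induction i generalizing s l with
    | zero => rfl
    | succ i ih =>
      rcases l with _ | ⟨b, l⟩ <;> rw [Function.iterate_succ_apply]
      · simpa using ih s []
      · exact ih (g c s b) l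
  obtain ⟨p, hp⟩ := hl.exists_inputSize_le
  have hloop : PolyTime fun c => step^[(l c).length] (c, s c, l c) := by
    refine iterate_while (test := fun a => !a.2.2.isEmpty) (by fun_prop) (by fun_prop) hstep
      (fun c => (l c).length) p (.X + B + p + 2)
      (fun c => (length_le_inputSize _).trans (hp c)) (fun c i _ => ?_) fun c i _ => ?_
    · rw [hiter, Bool.eq_iff_iff]
      simp
    · have hfold := hB c _ (List.take_prefix i (l c))
      have hdrop := (inputSize_le_of_suffix (List.drop_suffix i (l c))).trans (hp c)
      rw [hiter, inputSize_pair, inputSize_pair]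
      simp only [Polynomial.eval_add, Polynomial.eval_X, Polynomial.eval_ofNat]
      omega
  refine hloop.snd.fst.congr fun c => ?_
  rw [hiter, List.take_length]

@[fun_prop]
lemma reverse {l : γ → List α} (hl : PolyTime l) : PolyTime fun c => (l c).reverse := by
  obtain ⟨p, hp⟩ := hl.exists_inputSize_le
  refine (foldl (g := fun _ s a => a :: s) hl (.const ([] : List α)) (by fun_prop) p
    fun c l' hl' => ?_).congr fun c => by simp
  rw [List.foldl_flip_cons_eq_append', List.append_nil, inputSize_reverse]
  exact (inputSize_le_of_prefix hl').trans (hp c)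

@[fun_prop]
lemma append {l l' : γ → List α} (hl : PolyTime l) (hl' : PolyTime l') :
    PolyTime fun c => l c ++ l' c := by
  obtain ⟨p, hp⟩ := hl.exists_inputSize_le
  obtain ⟨q, hq⟩ := hl'.exists_inputSize_le
  refine (foldl (g := fun _ s a => a :: s) hl.reverse hl' (by fun_prop) (p + q)
    fun c k hk => ?_).congr fun c => by simp
  have hsize := inputSize_append k.reverse (l' c)
  have hk' := inputSize_le_of_prefix hk
  have := hp c
  have := hq c
  rw [List.foldl_flip_cons_eq_append', Polynomial.eval_add]
  rw [inputSize_reverse] at hsize hk'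
  omega

@[fun_prop]
lemma map {l : γ → List α} {f : γ → α → β} (hl : PolyTime l)
    (hf : PolyTime fun a : γ × α => f a.1 a.2) : PolyTime fun c => (l c).map (f c) := by
  obtain ⟨p, hp⟩ := hl.exists_inputSize_le
  obtain ⟨q, hq⟩ := hf.exists_inputSize_le
  have hfold (c : γ) (k : List α) :
      k.foldl (fun s a => f c a :: s) [] = (k.map (f c)).reverse := by simp
  refine (foldl (g := fun c s a => f c a :: s) hl (.const ([] : List β)) (by fun_prop)
    (p * (q.comp (.X + p + 1) + 1) + 1) fun c k hk => ?_).reverse.congr fun c => by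
      rw [hfold, List.reverse_reverse]
  rw [hfold, inputSize_reverse]
  have hlen : k.length ≤ p.eval (inputSize c) :=
    hk.length_le.trans ((length_le_inputSize _).trans (hp c))
  have himage : ∀ b ∈ k.map (f c), inputSize b ≤
      q.eval (inputSize c + p.eval (inputSize c) + 1) := by
    simp only [List.forall_mem_map]
    intro a ha
    have := (inputSize_le_of_mem (hk.subset ha)).trans (hp c)
    refine (hq (c, a)).trans (polynomial_eval_le_eval q ?_)
    rw [inputSize_pair]
    omega
  refine (inputSize_le_of_forall himage).trans ?_
  simp only [Polynomial.eval_add, Polynomial.eval_mul, Polynomial.eval_comp, Polynomial.eval_X,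
    Polynomial.eval_one, List.length_map]
  gcongr

@[fun_prop]
lemma flatten {l : γ → List (List α)} (hl : PolyTime l) : PolyTime fun c => (l c).flatten := by
  have hfold (k : List (List α)) (s : List α) : k.foldl (· ++ ·) s = s ++ k.flatten := by
    induction k generalizing s with
    | nil => simp
    | cons a k ih => simp [ih]
  obtain ⟨p, hp⟩ := hl.exists_inputSize_le
  refine (foldl (g := fun _ s a => s ++ a) hl (.const ([] : List α)) (by fun_prop) p
    fun c k hk => ?_).congr fun c => by rw [hfold, List.nil_append]
  rw [hfold, List.nil_append]
  exact (inputSize_flatten_le k).trans ((inputSize_le_of_prefix hk).trans (hp c))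

@[fun_prop]
lemma replicate_true {n : γ → ℕ} (hn : PolyTime n) :
    PolyTime fun c => List.replicate (n c) true :=
  hn.of_enc_eq (fun c => c) (fun _ => rfl) fun _ => rfl

@[fun_prop]
lemma length {l : γ → List α} (hl : PolyTime l) : PolyTime fun c => (l c).length :=
  (hl.map (f := fun _ _ => true) (.const true)).of_enc_eq (fun c => c) (fun _ => rfl) fun c => by
    rw [List.map_const']; rfl

lemma of_replicate_true {n : γ → ℕ} (hn : PolyTime fun c => List.replicate (n c) true) :
    PolyTime n :=
  hn.of_enc_eq (fun c => c) (fun _ => rfl) fun _ => rfl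

@[fun_prop]
lemma add {m n : γ → ℕ} (hm : PolyTime m) (hn : PolyTime n) : PolyTime fun c => m c + n c :=
  of_replicate_true <| (hm.replicate_true.append hn.replicate_true).congr fun c => by
    rw [List.replicate_append_replicate]

lemma iterate {n : γ → ℕ} {s : γ → σ} {g : γ → σ → σ} (hn : PolyTime n) (hs : PolyTime s)
    (hg : PolyTime fun a : γ × σ => g a.1 a.2) (B : Polynomial ℕ)
    (hB : ∀ c, ∀ i ≤ n c, inputSize ((g c)^[i] (s c)) ≤ B.eval (inputSize c)) :
    PolyTime fun c => (g c)^[n c] (s c) := by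
  have hfold (c : γ) (l : List Bool) (s : σ) :
      l.foldl (fun s _ => g c s) s = (g c)^[l.length] s := by
    induction l generalizing s with
    | nil => rfl
    | cons _ _ ih => exact ih (g c s)
  refine (foldl (g := fun c s _ => g c s) hn.replicate_true hs (by fun_prop) B
    fun c l' hl' => ?_).congr fun c => by rw [hfold, List.length_replicate]
  rw [hfold]
  exact hB c _ (by simpa using hl'.length_le)

@[fun_prop]
lemma drop {n : γ → ℕ} {l : γ → List α} (hn : PolyTime n) (hl : PolyTime l) :
    PolyTime fun c => (l c).drop (n c) := by
  have hiter (l : List α) (i : ℕ) : List.tail^[i] l = l.drop i := by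
    induction i with
    | zero => rfl
    | succ i ih => rw [Function.iterate_succ_apply', ih, List.tail_drop]
  obtain ⟨p, hp⟩ := hl.exists_inputSize_le
  refine (iterate (g := fun _ => List.tail) hn hl (by fun_prop) p fun c i _ => ?_).congr
    fun c => hiter _ _
  rw [hiter]
  exact (inputSize_le_of_suffix (List.drop_suffix i (l c))).trans (hp c)

@[fun_prop]
lemma sub {m n : γ → ℕ} (hm : PolyTime m) (hn : PolyTime n) : PolyTime fun c => m c - n c :=
  of_replicate_true <| (hn.drop hm.replicate_true).congr fun _ => List.drop_replicate

@[fun_prop]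
lemma mul {m n : γ → ℕ} (hm : PolyTime m) (hn : PolyTime n) : PolyTime fun c => m c * n c :=
  of_replicate_true <|
    (hm.replicate_true.map (f := fun c _ => List.replicate (n c) true)
      (by fun_prop)).flatten.congr fun c => by
        rw [List.map_replicate, List.flatten_replicate_replicate]

@[fun_prop]
lemma polynomial_eval (p : Polynomial ℕ) {n : γ → ℕ} (hn : PolyTime n) :
    PolyTime fun c => p.eval (n c) := by
  have hpow (k : ℕ) : PolyTime fun c => n c ^ k := by
    induction k with
    | zero => simpa using PolyTime.const 1
    | succ k ih => simpa only [pow_succ] using ih.mul hn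
  induction p using Polynomial.induction_on' with
  | add p q hp hq => simpa only [Polynomial.eval_add] using hp.add hq
  | monomial k a => simpa only [Polynomial.eval_monomial] using (PolyTime.const a).mul (hpow k)

@[fun_prop]
lemma decide_lt {m n : γ → ℕ} (hm : PolyTime m) (hn : PolyTime n) :
    PolyTime fun c => decide (m c < n c) :=
  (hn.sub hm).replicate_true.isEmpty.not.congr fun c => by
    rw [Bool.eq_iff_iff]
    simp [Nat.sub_eq_zero_iff_le]

@[fun_prop]
lemma take {n : γ → ℕ} {l : γ → List α} (hn : PolyTime n) (hl : PolyTime l) :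
    PolyTime fun c => (l c).take (n c) :=
  (drop (hl.reverse.length.sub hn) hl.reverse).reverse.congr fun c => by
    rw [← List.take_reverse, List.reverse_reverse]

@[fun_prop]
lemma replicate {n : γ → ℕ} {a : γ → α} (hn : PolyTime n) (ha : PolyTime a) :
    PolyTime fun c => List.replicate (n c) (a c) :=
  (hn.replicate_true.map (f := fun c _ => a c) (by fun_prop)).congr fun c => by
    rw [List.map_const', List.length_replicate]

@[fun_prop]
lemma getD {n : γ → ℕ} {l : γ → List α} {a : γ → α} (hn : PolyTime n) (hl : PolyTime l)
    (ha : PolyTime a) : PolyTime fun c => (l c).getD (n c) (a c) :=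
  ((hn.drop hl).headD ha).congr fun c => by
    rw [List.headD_eq_head?_getD, List.head?_drop, List.getD_eq_getElem?_getD]

end PolyTime

/-! ### Serialization of trees -/

namespace Val

/-- The vertices in depth-first order: `(true, true)` for a node and `(false, b)` for a leaf. -/
def vertices : Val → List (Bool × Bool)
  | atom b => [(false, b)]
  | node l r => (true, true) :: (l.vertices ++ r.vertices)

/-- Prefix-free serialization of a tree as a bit string, two bits for each vertex. -/
def ser (v : Val) : List Bool := v.vertices.flatMap fun b => [b.1, b.2]

lemma length_vertices (v : Val) : v.vertices.length = v.size := by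
  induction v with
  | atom b => rfl
  | node l r hl hr => simp [vertices, size, hl, hr]

lemma length_ser (v : Val) : v.ser.length = 2 * v.size := by
  simp [ser, List.length_flatMap, length_vertices, mul_comm]

lemma ser_node (l r : Val) : (node l r).ser = true :: true :: (l.ser ++ r.ser) := by
  simp [ser, vertices]

lemma ser_append_inj {v w : Val} {a b : List Bool} (h : v.ser ++ a = w.ser ++ b) :
    v = w ∧ a = b := by
  induction v generalizing w a b with
  | atom c =>
    cases w with
    | atom d => simpa [ser, vertices] using h
    | node l r => simp [ser, vertices] at h
  | node l r hl hr =>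
    cases w with
    | atom d => simp [ser, vertices] at h
    | node l' r' =>
      simp only [ser_node, List.cons_append, List.cons.injEq, true_and, List.append_assoc] at h
      obtain ⟨rfl, h'⟩ := hl h
      obtain ⟨rfl, h''⟩ := hr h'
      exact ⟨rfl, h''⟩

/-- One step of the depth-first traversal, on a state that consists of the stack of the trees that
are still to be visited and the list of visited vertices in reverse order. -/
def visit (s : List Val × List (Bool × Bool)) : List Val × List (Bool × Bool) :=
  List.casesOn (motive := fun _ => List Val × List (Bool × Bool)) s.1 s fun v st =>
    if v.isNode = true then (v.fst :: v.snd :: st, (true, true) :: s.2)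
    else (st, (false, v.isTrue) :: s.2)

lemma visit_node (l r : Val) (st : List Val) (out : List (Bool × Bool)) :
    visit (node l r :: st, out) = (l :: r :: st, (true, true) :: out) := rfl

lemma visit_atom (b : Bool) (st : List Val) (out : List (Bool × Bool)) :
    visit (atom b :: st, out) = (st, (false, b) :: out) := rfl

lemma visit_iterate (v : Val) (st : List Val) (out : List (Bool × Bool)) :
    visit^[v.size] (v :: st, out) = (st, v.vertices.reverse ++ out) := by
  induction v generalizing st out with
  | atom b => rfl
  | node l r hl hr =>
    rw [size, Function.iterate_succ_apply, visit_node, add_comm, Function.iterate_add_apply, hl, hr]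
    simp [vertices]

lemma visit_iterate_invariant (v : Val) (i : ℕ) (hi : i ≤ v.size) :
    ((visit^[i] ([v], [])).1.map size).sum + i = v.size ∧
      (visit^[i] ([v], [])).2.length = i := by
  induction i with
  | zero => simp
  | succ i ih =>
    obtain ⟨hsum, hlen⟩ := ih (by omega)
    rw [Function.iterate_succ_apply']
    rcases hs : visit^[i] ([v], []) with ⟨_ | ⟨_ | ⟨l, r⟩, st⟩, out⟩ <;> rw [hs] at hsum hlen
    · simp only [List.map_nil, List.sum_nil] at hsum
      omega
    all_goals
      simp only [visit_atom, visit_node, size, List.map_cons, List.sum_cons,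
        List.length_cons] at hsum hlen ⊢
      omega

end Val

lemma inputSize_val_list_le (l : List Val) :
    inputSize l ≤ 2 * (l.map Val.size).sum + 1 := by
  induction l with
  | nil => rfl
  | cons v l ih =>
    have hv : inputSize v = v.size := rfl
    have := v.one_le_size
    rw [inputSize_cons, List.map_cons, List.sum_cons]
    omega

namespace PolyTime

@[fun_prop]
lemma valFst : PolyTime Val.fst :=
  polyTime_iff.2 ⟨.fst, .X + 1, trivial, fun v => ⟨_, by simp [inputSize, HasVal.enc], .fst v⟩⟩

@[fun_prop]
lemma valSnd : PolyTime Val.snd :=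
  polyTime_iff.2 ⟨.snd, .X + 1, trivial, fun v => ⟨_, by simp [inputSize, HasVal.enc], .snd v⟩⟩

@[fun_prop]
lemma valIsNode : PolyTime Val.isNode :=
  polyTime_iff.2
    ⟨.isNode, .X + 1, trivial, fun v => ⟨_, by simp [inputSize, HasVal.enc], .isNode v⟩⟩

@[fun_prop]
lemma valIsTrue : PolyTime Val.isTrue := by
  refine polyTime_iff.2 ⟨.ite .id (.const true) (.const false), 3 * .X + 3,
    ⟨trivial, trivial, trivial⟩, fun v => ⟨v.size + 1 + (v.size + 1) + v.size + 1, ?_, ?_⟩⟩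
  · simp only [Polynomial.eval_add, Polynomial.eval_mul, Polynomial.eval_X, Polynomial.eval_ofNat,
      inputSize, HasVal.enc]
    omega
  · rcases hv : v.isTrue with _ | _
    · exact .ite_false (.id v) hv (.const _ _)
    · exact .ite_true (.id v) hv (.const _ _)

@[fun_prop]
lemma visit : PolyTime Val.visit := by
  unfold Val.visit
  fun_prop

@[fun_prop]
lemma vertices : PolyTime Val.vertices := by
  have hloop : PolyTime fun v : Val => Val.visit^[v.size] ([v], []) := by
    refine iterate_while (test := fun s => !s.1.isEmpty) (by fun_prop) (by fun_prop) visit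
      Val.size .X (6 * .X + 3) (fun v => by simp [inputSize, HasVal.enc]) (fun v i hi => ?_)
      fun v i hi => ?_
    all_goals obtain ⟨hsum, hlen⟩ := v.visit_iterate_invariant i hi
    all_goals
      generalize Val.visit^[i] ([v], []) = s at hsum hlen ⊢
      rcases s with ⟨st, out⟩
    · rcases st with _ | ⟨w, st⟩
      · simp_all
      · have := w.one_le_size
        simp only [List.map_cons, List.sum_cons] at hsum
        simp only [List.isEmpty_cons, Bool.not_false, Bool.true_eq, decide_eq_true_eq]
        omega
    · have hst := inputSize_val_list_le st
      have hout : inputSize out ≤ out.length * (3 + 1) + 1 :=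
        inputSize_le_of_forall fun _ _ => le_rfl
      have hv : inputSize v = v.size := rfl
      rw [inputSize_pair]
      simp only [Polynomial.eval_add, Polynomial.eval_mul, Polynomial.eval_X, Polynomial.eval_ofNat]
      simp only at hsum hlen
      omega
  refine hloop.snd.reverse.congr fun v => ?_
  rw [Val.visit_iterate, List.append_nil, List.reverse_reverse]

@[fun_prop]
lemma enc {f : α → β} (hf : PolyTime f) : PolyTime fun a => HasVal.enc (f a) :=
  hf.of_enc_eq (fun c => c) (fun _ => rfl) fun _ => rfl

@[fun_prop]
lemma inputSize {f : α → β} (hf : PolyTime f) : PolyTime fun a => inputSize (f a) :=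
  (vertices.comp hf.enc).length.congr fun _ => Val.length_vertices _

@[fun_prop]
lemma ser {f : α → Val} (hf : PolyTime f) : PolyTime fun a => (f a).ser :=
  (flatten (l := fun a => (f a).vertices.map fun b => [b.1, b.2]) (by fun_prop)).congr fun _ =>
    List.flatMap_def.symm

end PolyTime

/-- Truncate a string, or extend it by zeros, to length `m`. -/
def pad (m : ℕ) (l : List Bool) : List Bool := (l ++ List.replicate m false).take m

lemma length_pad (m : ℕ) (l : List Bool) : (pad m l).length = m := by
  simp [pad]

lemma pad_of_length_le {m : ℕ} {l : List Bool} (h : l.length ≤ m) :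
    pad m l = l ++ List.replicate (m - l.length) false := by
  rw [pad, List.take_append, List.take_of_length_le h, List.take_replicate, Nat.min_eq_left]
  omega

@[fun_prop]
lemma PolyTime.pad {m : γ → ℕ} {l : γ → List Bool} (hm : PolyTime m) (hl : PolyTime l) :
    PolyTime fun c => pad (m c) (l c) := by
  unfold PublicCoinZK.pad
  fun_prop

end

/-! ### Uniform strings and probabilistic polynomial time -/

section

variable {α β : Type}

lemma pmf_bind_congr {p : PMF α} {f g : α → PMF β} (h : ∀ a ∈ p.support, f a = g a) :
    p.bind f = p.bind g := by
  rw [← PMF.bindOnSupport_eq_bind, ← PMF.bindOnSupport_eq_bind]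
  congr 1
  funext a ha
  exact h a ha

lemma pmf_map_congr {p : PMF α} {f g : α → β} (h : ∀ a ∈ p.support, f a = g a) :
    p.map f = p.map g :=
  pmf_bind_congr fun a ha => by rw [Function.comp_apply, Function.comp_apply, h a ha]

end

lemma unif_apply (n : ℕ) (l : List Bool) :
    unif n l = if l.length = n then ((2 : ENNReal) ^ n)⁻¹ else 0 := by
  rw [unif, PMF.map_apply]
  split_ifs with h
  · subst h
    rw [tsum_eq_single l.get]
    · simp [PMF.uniformOfFintype_apply]
    · exact fun f hf => if_neg fun h => hf <| List.ofFn_injective <| by rw [← h, List.ofFn_get]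
  · exact ENNReal.tsum_eq_zero.2 fun f => if_neg fun hf => h (by simp [hf])

lemma mem_support_unif {n : ℕ} {l : List Bool} : l ∈ (unif n).support ↔ l.length = n := by
  rw [PMF.mem_support_iff, unif_apply]
  by_cases h : l.length = n <;> simp [h]

lemma unif_add (a b : ℕ) :
    unif (a + b) = (unif a).bind fun u => (unif b).map fun v => u ++ v := by
  ext l
  have hmap (u : List Bool) (hu : u.length = a) :
      (unif b).map (fun v => u ++ v) l = if u = l.take a then unif b (l.drop a) else 0 := by
    rw [PMF.map_apply]
    split_ifs with h
    · rw [tsum_eq_single (l.drop a), h, if_pos (List.take_append_drop a l).symm]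
      rintro v hv
      refine if_neg fun hl => hv ?_
      rw [hl, ← hu, List.drop_left]
    · refine ENNReal.tsum_eq_zero.2 fun v => if_neg fun hl => h ?_
      rw [hl, ← hu, List.take_left]
  rw [PMF.bind_apply, tsum_eq_single (l.take a)]
  · by_cases h : (l.take a).length = a
    · rw [hmap _ h, if_pos rfl, unif_apply, unif_apply, unif_apply, if_pos h]
      have hl : (l.drop a).length = b ↔ l.length = a + b := by
        rw [List.length_take] at h
        rw [List.length_drop]
        omega
      by_cases hb : l.length = a + b
      · rw [if_pos hb, if_pos (hl.2 hb), pow_add, ENNReal.mul_inv] <;> simp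
      · rw [if_neg hb, if_neg (mt hl.1 hb), mul_zero]
    · rw [unif_apply, unif_apply, if_neg h, zero_mul, if_neg]
      rw [List.length_take] at h
      omega
  · intro u hu
    by_cases h : u.length = a
    · rw [hmap u h, if_neg hu, mul_zero]
    · rw [unif_apply, if_neg h, zero_mul]

lemma unif_map_take {a m : ℕ} (h : a ≤ m) : (unif m).map (List.take a) = unif a := by
  obtain ⟨b, rfl⟩ := Nat.exists_eq_add_of_le h
  have htake : ∀ u ∈ (unif a).support,
      ((unif b).map fun v => u ++ v).map (List.take a) = PMF.pure u := fun u hu => by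
    rw [mem_support_unif] at hu
    subst hu
    simp only [PMF.map_comp, Function.comp_def, List.take_left]
    exact PMF.map_const _ _
  rw [unif_add, PMF.map_bind, pmf_bind_congr htake, PMF.bind_pure]

section

variable {α β γ σ : Type} [HasVal α] [HasVal β] [HasVal γ] [HasVal σ]

/-- The coins of a sampler may be taken from any sufficiently long uniform string. -/
lemma ppt_iff {A : α → PMF β} : PPT A ↔ ∃ (h : α × List Bool → β) (q : Polynomial ℕ), PolyTime h ∧
    ∀ a : α, ∀ m ≥ q.eval (inputSize a), A a = (unif m).map fun ρ => h (a, ρ) := by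
  constructor
  · rintro ⟨h, q, hh, hA⟩
    refine ⟨fun a => h (a.1, a.2.take (q.eval (inputSize a.1))), q, by fun_prop, fun a m hm => ?_⟩
    rw [hA, ← unif_map_take hm, PMF.map_comp]
    rfl
  · rintro ⟨h, q, hh, hA⟩
    exact ⟨h, q, hh, fun a => hA a _ le_rfl⟩

namespace PPT

lemma of_polyTime {f : α → β} (hf : PolyTime f) : PPT fun a => PMF.pure (f a) :=
  ppt_iff.2 ⟨fun a => f a.1, 0, by fun_prop, fun _ _ _ => (PMF.map_const _ _).symm⟩

protected lemma unif {n : α → ℕ} (hn : PolyTime n) : PPT fun a => unif (n a) := by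
  obtain ⟨p, hp⟩ := hn.exists_inputSize_le
  refine ppt_iff.2 ⟨fun a => a.2.take (n a.1), p, by fun_prop, fun a m hm => ?_⟩
  have := hp a
  rw [inputSize_nat] at this
  exact (unif_map_take (by omega)).symm

lemma comp {A : β → PMF γ} {f : α → β} (hA : PPT A) (hf : PolyTime f) :
    PPT fun a => A (f a) := by
  obtain ⟨h, q, hh, hA⟩ := ppt_iff.1 hA
  obtain ⟨p, hp⟩ := hf.exists_inputSize_le
  refine ppt_iff.2 ⟨fun a => h (f a.1, a.2), q.comp p, by fun_prop, fun a m hm => hA _ _ ?_⟩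
  rw [Polynomial.eval_comp] at hm
  exact (polynomial_eval_le_eval q (hp a)).trans hm

lemma bind {A : α → PMF β} {B : α → β → PMF γ} (hA : PPT A)
    (hB : PPT fun a : α × β => B a.1 a.2) : PPT fun a => (A a).bind (B a) := by
  obtain ⟨h, q, hh, hA⟩ := ppt_iff.1 hA
  obtain ⟨h', q', hh', hB⟩ := ppt_iff.1 hB
  obtain ⟨p, hp⟩ := hh.exists_inputSize_le
  refine ppt_iff.2 ⟨fun a => h' ((a.1, h (a.1, a.2.take (q.eval (inputSize a.1)))),
    a.2.drop (q.eval (inputSize a.1))), q + q'.comp (.X + p.comp (.X + 2 * q + 2) + 1),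
    by fun_prop, fun a m hm => ?_⟩
  simp only [Polynomial.eval_add, Polynomial.eval_comp, Polynomial.eval_X, Polynomial.eval_one,
    Polynomial.eval_mul, Polynomial.eval_ofNat] at hm
  set k := q.eval (inputSize a) with hk
  obtain ⟨m', rfl⟩ := Nat.exists_eq_add_of_le ((Nat.le_add_right _ _).trans hm)
  rw [unif_add, PMF.map_bind, hA a k le_rfl, PMF.bind_map]
  refine pmf_bind_congr fun u hu => ?_
  rw [mem_support_unif] at hu
  have hm' : q'.eval (inputSize (a, h (a, u))) ≤ m' := by
    have hsize : inputSize (a, u) = inputSize a + 2 * k + 2 := by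
      rw [inputSize_pair, inputSize_bits, hu]
      ring
    have hle := hp (a, u)
    rw [hsize] at hle
    refine (polynomial_eval_le_eval q' ?_).trans (Nat.le_of_add_le_add_left hm)
    rw [inputSize_pair]
    omega
  rw [PMF.map_comp, Function.comp_apply, hB (a, h (a, u)) m' hm']
  congr 1
  funext v
  simp only [Function.comp_apply, ← hk, ← hu, List.take_left, List.drop_left]

lemma map {A : α → PMF β} {f : α → β → γ} (hA : PPT A)
    (hf : PolyTime fun a : α × β => f a.1 a.2) : PPT fun a => (A a).map (f a) :=
  hA.bind (B := fun a b => PMF.pure (f a b)) (.of_polyTime hf)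

end PPT

/-- The `n`-fold iteration of a randomized step. -/
noncomputable def iterateBind {σ : Type} (K : σ → PMF σ) : ℕ → σ → PMF σ
  | 0, s => PMF.pure s
  | n + 1, s => (K s).bind (iterateBind K n)

/-- One step of an iteration that takes the `Q` coins of each step off the front of a string. The
coins are padded so that the step makes sense also when the string is exhausted. -/
def coinStep {σ : Type} (h : σ × List Bool → σ) (Q : ℕ) (a : σ × List Bool) : σ × List Bool :=
  (h (a.1, pad Q a.2), a.2.drop Q)

section coinStep

variable {σ : Type} {K : σ → PMF σ} {h : σ × List Bool → σ} {Q n : ℕ} {s : σ}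

lemma coinStep_append {u v : List Bool} (hu : u.length = Q) :
    coinStep h Q (s, u ++ v) = (h (s, u), v) := by
  subst hu
  simp [coinStep, pad, List.append_assoc]

lemma length_coinStep_iterate_le (h : σ × List Bool → σ) (Q n : ℕ) (a : σ × List Bool) :
    ((coinStep h Q)^[n] a).2.length ≤ a.2.length := by
  induction n generalizing a with
  | zero => exact le_rfl
  | succ n ih =>
    refine (ih _).trans ?_
    rw [coinStep, List.length_drop]
    exact Nat.sub_le _ _

lemma coinStep_iterate_mem_support
    (hK : ∀ i < n, ∀ s' ∈ (iterateBind K i s).support, K s' = (unif Q).map fun ρ => h (s', ρ))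
    (ρ : List Bool) : ((coinStep h Q)^[n] (s, ρ)).1 ∈ (iterateBind K n s).support := by
  induction n generalizing s ρ with
  | zero => simp [iterateBind]
  | succ n ih =>
    have hs := hK 0 n.succ_pos s (by simp [iterateBind])
    have hstep : h (s, pad Q ρ) ∈ (K s).support := by
      rw [hs, PMF.mem_support_map_iff]
      exact ⟨_, mem_support_unif.2 (length_pad Q ρ), rfl⟩
    refine (PMF.mem_support_bind_iff _ _ _).2 ⟨_, hstep, ih (fun i hi s' hs' => ?_) _⟩
    exact hK (i + 1) (by omega) s' ((PMF.mem_support_bind_iff _ _ _).2 ⟨_, hstep, hs'⟩)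

lemma map_coinStep_iterate {m : ℕ} (hm : n * Q ≤ m)
    (hK : ∀ i < n, ∀ s' ∈ (iterateBind K i s).support, K s' = (unif Q).map fun ρ => h (s', ρ)) :
    (unif m).map (fun ρ => ((coinStep h Q)^[n] (s, ρ)).1) = iterateBind K n s := by
  induction n generalizing s m with
  | zero => exact PMF.map_const _ _
  | succ n ih =>
    have hs := hK 0 n.succ_pos s (by simp [iterateBind])
    rw [add_mul, one_mul] at hm
    obtain ⟨m, rfl⟩ := Nat.exists_eq_add_of_le ((Nat.le_add_left Q _).trans hm)
    rw [iterateBind, hs, PMF.bind_map, unif_add, PMF.map_bind]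
    refine pmf_bind_congr fun u hu => ?_
    rw [PMF.map_comp, Function.comp_apply,
      ← ih (s := h (s, u)) (m := m) (by omega) fun i hi s' hs' => ?_]
    · simp only [Function.comp_def, Function.iterate_succ_apply,
        coinStep_append (mem_support_unif.1 hu)]
    · refine hK (i + 1) (by omega) s' ((PMF.mem_support_bind_iff _ _ _).2 ⟨_, ?_, hs'⟩)
      rw [hs, PMF.mem_support_map_iff]
      exact ⟨u, hu, rfl⟩

end coinStep

@[fun_prop]
lemma PolyTime.coinStep {h : γ → σ × List Bool → σ} {Q : γ → ℕ} {a : γ → σ × List Bool}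
    (hh : PolyTime fun c : γ × σ × List Bool => h c.1 c.2) (hQ : PolyTime Q) (ha : PolyTime a) :
    PolyTime fun c => coinStep (h c) (Q c) (a c) := by
  unfold PublicCoinZK.coinStep
  fun_prop

lemma PPT.iterateBind {K : γ → σ → PMF σ} {n : γ → ℕ} {s : γ → σ}
    (hK : PPT fun a : γ × σ => K a.1 a.2) (hn : PolyTime n) (hs : PolyTime s) (B : Polynomial ℕ)
    (hB : ∀ c, ∀ i ≤ n c, ∀ s' ∈ (iterateBind (K c) i (s c)).support,
      inputSize s' ≤ B.eval (inputSize c)) :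
    PPT fun c => iterateBind (K c) (n c) (s c) := by
  obtain ⟨h, q, hh, hK⟩ := ppt_iff.1 hK
  obtain ⟨p, hp⟩ := hn.exists_inputSize_le
  set Qp : Polynomial ℕ := q.comp (.X + B + 1) with hQp
  let Q : γ → ℕ := fun c => Qp.eval (PublicCoinZK.inputSize c)
  have hQ (c : γ) : ∀ i ≤ n c, ∀ s' ∈ (PublicCoinZK.iterateBind (K c) i (s c)).support,
      K c s' = (unif (Q c)).map fun ρ => h ((c, s'), ρ) := fun i hi s' hs' => by
    refine hK (c, s') _ ?_
    simp only [Q, hQp, Polynomial.eval_comp, Polynomial.eval_add, Polynomial.eval_X,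
      Polynomial.eval_one, inputSize_pair]
    gcongr
    exact hB c i hi s' hs'
  let f : γ × List Bool → σ × List Bool := fun c =>
    (coinStep (fun a => h ((c.1, a.1), a.2)) (Q c.1))^[n c.1] (s c.1, c.2)
  have hf : PolyTime f := by
    refine PolyTime.iterate (B := B + .X + 1) (by fun_prop) (by fun_prop) (by fun_prop)
      fun c i hi => ?_
    set b := (coinStep (fun a => h ((c.1, a.1), a.2)) (Q c.1))^[i] (s c.1, c.2)
    have hfst : inputSize b.1 ≤ B.eval (inputSize c.1) :=
      hB c.1 i hi _ (coinStep_iterate_mem_support (fun j hj => hQ c.1 j (by omega)) c.2)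
    have hsnd : b.2.length ≤ c.2.length := length_coinStep_iterate_le _ _ _ _
    have hmono : B.eval (inputSize c.1) ≤ B.eval (inputSize c) :=
      polynomial_eval_le_eval B (by rw [inputSize_pair]; omega)
    have hc : inputSize c = inputSize c.1 + inputSize c.2 + 1 := rfl
    have hb' : inputSize b = inputSize b.1 + inputSize b.2 + 1 := rfl
    simp only [Polynomial.eval_add, Polynomial.eval_X, Polynomial.eval_one]
    rw [inputSize_bits] at hc hb'
    omega
  refine ppt_iff.2 ⟨fun c => (f c).1, p * Qp, hf.fst, fun c m hm => ?_⟩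
  have hn' : n c * Q c ≤ m := by
    have := hp c
    rw [inputSize_nat] at this
    rw [Polynomial.eval_mul] at hm
    exact (Nat.mul_le_mul_right _ (by omega)).trans hm
  exact (map_coinStep_iterate (K := K c) (h := fun a => h ((c, a.1), a.2)) hn'
    fun i hi => hQ c i hi.le).symm

end

/-! ### Oracle programs that query the oracle in a loop -/

section

variable {α β σ : Type} [HasVal α] [HasVal β] [HasVal σ]

/-- The outcome `r` of a randomized run, a result with a number of steps, is an encoded sample of
`P`, obtained in at most `T` steps. -/
def SamplesWithin (r : PMF (Val × ℕ)) (P : PMF α) (T : ℕ) : Prop :=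
  r.map Prod.fst = P.map HasVal.enc ∧ ∀ o ∈ r.support, o.2 ≤ T

namespace SamplesWithin

variable {O : Oracle PMF} {N T T' : ℕ} {c d : Code} {v : Val} {P : PMF α}

lemma pure {a : α} {s : ℕ} (h : s ≤ T) :
    SamplesWithin (PMF.pure (HasVal.enc a, s)) (PMF.pure a) T :=
  ⟨by rw [PMF.pure_map, PMF.pure_map], fun o ho => by rwa [(PMF.mem_support_pure_iff _ _).1 ho]⟩

lemma mono {r : PMF (Val × ℕ)} (h : SamplesWithin r P T) (hT : T ≤ T') : SamplesWithin r P T' :=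
  ⟨h.1, fun o ho => (h.2 o ho).trans hT⟩

lemma bind {r : PMF (Val × ℕ)} {f : Val × ℕ → PMF (Val × ℕ)} {Q : α → PMF β}
    (hr : SamplesWithin r P T)
    (hf : ∀ a ∈ P.support, ∀ s ≤ T, SamplesWithin (f (HasVal.enc a, s)) (Q a) T') :
    SamplesWithin (r.bind f) (P.bind Q) T' := by
  have hsupp : ∀ o ∈ r.support, ∃ a ∈ P.support, HasVal.enc a = o.1 := fun o ho => by
    rw [← PMF.mem_support_map_iff, ← hr.1]
    exact (PMF.mem_support_map_iff _ _ _).2 ⟨o, ho, rfl⟩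
  constructor
  · -- On the support of `r`, the distribution of the result of `f` ignores the step count.
    have hfst : ∀ o ∈ r.support, (f o).map Prod.fst = (f (o.1, 0)).map Prod.fst := fun o ho => by
      obtain ⟨a, ha, hao⟩ := hsupp o ho
      rw [← Prod.mk.eta (p := o), ← hao, (hf a ha _ (hr.2 o ho)).1, (hf a ha 0 T.zero_le).1]
    calc (r.bind f).map Prod.fst = (r.map Prod.fst).bind fun v => (f (v, 0)).map Prod.fst := by
          rw [PMF.map_bind, PMF.bind_map]
          exact pmf_bind_congr hfst
      _ = (P.bind Q).map HasVal.enc := by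
          rw [hr.1, PMF.bind_map, PMF.map_bind]
          exact pmf_bind_congr fun a ha => (hf a ha 0 T.zero_le).1
  · intro o ho
    obtain ⟨o', ho', ho⟩ := (PMF.mem_support_bind_iff _ _ _).1 ho
    obtain ⟨a, ha, hao⟩ := hsupp o' ho'
    refine (hf a ha o'.2 (hr.2 o' ho')).2 o ?_
    rwa [hao]

lemma seq {Q : α → PMF β} (hc : SamplesWithin (c.run O N v) P T)
    (hd : ∀ a ∈ P.support, SamplesWithin (d.run O N (HasVal.enc a)) (Q a) T') :
    SamplesWithin ((Code.seq c d).run O N v) (P.bind Q) (T + T' + 1) := by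
  refine hc.bind fun a ha s hs => ?_
  rw [← (Q a).bind_pure]
  exact (hd a ha).bind fun _ _ s' hs' => pure (by dsimp only; omega)

lemma pure_seq {a : α} {Q : PMF β} (hc : SamplesWithin (c.run O N v) (PMF.pure a) T)
    (hd : SamplesWithin (d.run O N (HasVal.enc a)) Q T') :
    SamplesWithin ((Code.seq c d).run O N v) Q (T + T' + 1) := by
  rw [← PMF.pure_bind a fun _ => Q]
  refine hc.seq fun a' ha' => ?_
  rwa [(PMF.mem_support_pure_iff _ _).1 ha']

lemma pair {Q : PMF β} (hc : SamplesWithin (c.run O N v) P T)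
    (hd : SamplesWithin (d.run O N v) Q T') :
    SamplesWithin ((Code.pair c d).run O N v) (P.bind fun a => Q.map fun b => (a, b))
      (T + T' + v.size + 1) :=
  hc.bind fun a _ s hs => hd.bind fun b _ s' hs' =>
    pure (a := (a, b)) (by dsimp only; omega)

lemma ask (O : Oracle PMF) (N : ℕ) (q : List Bool × List Bool × List Bool) :
    SamplesWithin (Code.ask.run O N (HasVal.enc q)) ((O q.2).map fun a => a.take q.1.length)
      (2 * inputSize q) := by
  have hrun : Code.ask.run O N (HasVal.enc q) = (O q.2).map fun a =>
      (HasVal.enc (a.take q.1.length), inputSize q + inputSize (a.take q.1.length) + 1) := by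
    have h₁ : (HasVal.enc q : Val).fst.toBits = q.1 := Val.toBits_enc _
    have h₂ : (HasVal.enc q : Val).snd.fst.toBits = q.2.1 := Val.toBits_enc _
    have h₃ : (HasVal.enc q : Val).snd.snd.toBits = q.2.2 := Val.toBits_enc _
    rw [Code.run, h₁, h₂, h₃]
    rfl
  rw [hrun]
  refine ⟨by simp only [PMF.map_comp, Function.comp_def], fun o ho => ?_⟩
  obtain ⟨a, -, rfl⟩ := (PMF.mem_support_map_iff _ _ _).1 ho
  have := a.length_take_le q.1.length
  have hq : inputSize q = inputSize q.1 + inputSize q.2 + 1 := rfl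
  simp only [inputSize_bits] at hq ⊢
  omega

lemma of_eval {a : α} {s : ℕ} (h : Eval c v (HasVal.enc a) s) (O : Oracle PMF)
    (hN : s ≤ N) : SamplesWithin (c.run O N v) (PMF.pure a) s := by
  rw [h.run O hN]
  exact pure le_rfl

lemma of_forall_eval {f : α → β} {p : Polynomial ℕ}
    (hf : ∀ a, ∃ s ≤ p.eval (inputSize a), Eval c (HasVal.enc a) (HasVal.enc (f a)) s)
    (O : Oracle PMF) {B : ℕ} (hB : p.eval B ≤ N) {a : α} (ha : inputSize a ≤ B) :
    SamplesWithin (c.run O N (HasVal.enc a)) (PMF.pure (f a)) (p.eval B) := by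
  obtain ⟨s, hs, he⟩ := hf a
  have hs' := hs.trans (polynomial_eval_le_eval p ha)
  exact (of_eval he O (hs'.trans hB)).mono hs'

end SamplesWithin

/-- One oracle query: `query` computes a bound on the length of the answer and the query, and `upd`
computes the new state from the old state and the truncated answer. -/
noncomputable def oracleStep {σ : Type} (query : σ → List Bool × List Bool × List Bool)
    (upd : σ × List Bool → σ) (O : Oracle PMF) (s : σ) : PMF σ :=
  (O (query s).2).map fun a => upd (s, a.take (query s).1.length)

lemma exists_code_oracleStep {query : σ → List Bool × List Bool × List Bool}
    {upd : σ × List Bool → σ} (hq : PolyTime query) (hu : PolyTime upd) :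
    ∃ (c : Code) (p : Polynomial ℕ), ∀ (O : Oracle PMF) (N : ℕ) (s : σ), p.eval (inputSize s) ≤ N →
      SamplesWithin (c.run O N (HasVal.enc s)) (oracleStep query upd O s)
        (p.eval (inputSize s)) := by
  obtain ⟨cq, pq, -, hq⟩ := polyTime_iff.1 hq
  obtain ⟨cu, pu, -, hu⟩ := polyTime_iff.1 hu
  refine ⟨.seq (.pair .id (.seq cq .ask)) cu, 3 * pq + 2 * .X + 4 + pu.comp (.X + pq + 1),
    fun O N s hN => ?_⟩
  simp only [Polynomial.eval_add, Polynomial.eval_mul, Polynomial.eval_comp, Polynomial.eval_X,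
    Polynomial.eval_one, Polynomial.eval_ofNat] at hN ⊢
  have hquery : inputSize (query s) ≤ pq.eval (inputSize s) := by
    obtain ⟨sq, hsq, heq⟩ := hq s
    exact heq.size_le.trans hsq
  have hid : SamplesWithin (Code.id.run O N (HasVal.enc s)) (PMF.pure s) (inputSize s + 1) :=
    .of_eval (.id _) O (by rw [← inputSize]; omega)
  have hcall := (SamplesWithin.of_forall_eval hq O (by omega) le_rfl).pure_seq (.ask O N (query s))
  have hupd := (hid.pair hcall).seq (d := cu) (Q := fun a => PMF.pure (upd a))
    (T' := pu.eval (inputSize s + pq.eval (inputSize s) + 1)) fun a ha => by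
      refine .of_forall_eval hu O (by omega) ?_
      simp only [PMF.pure_bind, PMF.map_comp, PMF.mem_support_map_iff] at ha
      obtain ⟨b, -, rfl⟩ := ha
      have := b.length_take_le (query s).1.length
      have hsize : inputSize (query s) = inputSize (query s).1 + inputSize (query s).2 + 1 := rfl
      simp only [Function.comp_apply, inputSize_pair, inputSize_bits] at hsize ⊢
      omega
  have hdist : oracleStep query upd O s = ((PMF.pure s).bind fun a =>
      ((O (query s).2).map fun b => b.take (query s).1.length).map fun b => (a, b)).bind fun a =>
        PMF.pure (upd a) := by
    rw [PMF.pure_bind, PMF.map_comp, PMF.bind_map]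
    rfl
  rw [hdist]
  refine hupd.mono ?_
  rw [← inputSize]
  omega

/-- An invariant of the iteration of a randomized step `K` as long as `test` holds: `Inv i s` says
that `i` iterations are left in the state `s`, and it bounds the size of `s` by `S`. -/
structure LoopInvariant (test : σ → Bool) (K : σ → PMF σ) (S : ℕ) (Inv : ℕ → σ → Prop) : Prop where
  size : ∀ i s, Inv i s → inputSize s ≤ S
  finished : ∀ s, Inv 0 s → test s = false
  running : ∀ i s, Inv (i + 1) s → test s = true
  next : ∀ i s, Inv (i + 1) s → ∀ s' ∈ (K s).support, Inv i s'

namespace LoopInvariant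

variable {test : σ → Bool} {K : σ → PMF σ} {S : ℕ} {Inv : ℕ → σ → Prop}

lemma iterateBind (hI : LoopInvariant test K S Inv) {i j : ℕ} {s : σ} (hs : Inv (i + j) s) :
    ∀ s' ∈ (iterateBind K i s).support, Inv j s' := by
  induction i generalizing s with
  | zero =>
    intro s' hs'
    rwa [(PMF.mem_support_pure_iff _ _).1 hs', ← zero_add j]
  | succ i ih =>
    intro s' hs'
    obtain ⟨u, hu, hs'⟩ := (PMF.mem_support_bind_iff _ _ _).1 hs'
    rw [add_right_comm] at hs
    exact ih (hI.next _ s hs u hu) s' hs'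

lemma whileLoop (hI : LoopInvariant test K S Inv) {t c : Val → PMF (Val × ℕ)} {T C : ℕ}
    (ht : ∀ s, inputSize s ≤ S → SamplesWithin (t (HasVal.enc s)) (PMF.pure (test s)) T)
    (hc : ∀ s, inputSize s ≤ S → SamplesWithin (c (HasVal.enc s)) (K s) C)
    {i M : ℕ} (hM : i < M) {s : σ} (hs : Inv i s) :
    SamplesWithin (whileLoop t c M (HasVal.enc s)) (PublicCoinZK.iterateBind K i s)
      (i * (T + C) + (T + S + 1)) := by
  obtain ⟨M, rfl⟩ := Nat.exists_eq_add_of_lt hM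
  induction i generalizing s with
  | zero =>
    have hS := hI.size _ _ hs
    rw [PublicCoinZK.iterateBind, ← PMF.pure_bind (test s) fun _ => PMF.pure s]
    refine (ht s hS).bind fun b hb k hk => ?_
    obtain rfl := (PMF.mem_support_pure_iff _ _).1 hb
    rw [hI.finished s hs]
    exact .pure (by rw [← inputSize]; omega)
  | succ i ih =>
    have hS := hI.size _ _ hs
    rw [PublicCoinZK.iterateBind, ← PMF.pure_bind (test s) fun _ => (K s).bind _]
    refine (ht s hS).bind fun b hb k hk => ?_
    obtain rfl := (PMF.mem_support_pure_iff _ _).1 hb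
    rw [hI.running i s hs]
    refine (hc s hS).bind fun s' hs' k' hk' => ?_
    rw [← (PublicCoinZK.iterateBind K i s').bind_pure, add_right_comm i 1 M]
    refine (ih (hI.next i s hs s' hs') (by omega)).bind fun u _ k'' hk'' => .pure ?_
    rw [add_mul, one_mul]
    dsimp only
    omega

end LoopInvariant

theorem oraclePolyTime_loop {init : List Bool × List Bool → σ} {test : σ → Bool}
    {query : σ → List Bool × List Bool × List Bool} {upd : σ × List Bool → σ} {fin : σ → Bool}
    (hinit : PolyTime init) (htest : PolyTime test) (hquery : PolyTime query)
    (hupd : PolyTime upd) (hfin : PolyTime fin) (rounds : List Bool → ℕ) (q T S : Polynomial ℕ)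
    (Inv : List Bool → ℕ → σ → Prop) (hT : ∀ x, rounds x ≤ T.eval x.length)
    (hI : ∀ O x, LoopInvariant test (oracleStep query upd O) (S.eval x.length) (Inv x))
    (hstart : ∀ x ρ : List Bool, ρ.length = q.eval x.length → Inv x (rounds x) (init (x, ρ))) :
    OraclePolyTime fun O x => (unif (q.eval x.length)).bind fun ρ =>
      (iterateBind (oracleStep query upd O) (rounds x) (init (x, ρ))).map fin := by
  obtain ⟨c₀, p₀, -, h₀⟩ := polyTime_iff.1 hinit
  obtain ⟨t, pt, -, ht⟩ := polyTime_iff.1 htest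
  obtain ⟨c₁, p₁, -, h₁⟩ := polyTime_iff.1 hfin
  obtain ⟨c, pc, hc⟩ := exists_code_oracleStep hquery hupd
  let p : Polynomial ℕ := p₀.comp (2 * .X + 2 * q + 3) + T * (pt.comp S + pc.comp S) + pt.comp S +
    pc.comp S + S + p₁.comp S + T + 4
  suffices hrun : ∀ (O : Oracle PMF) (x ρ : List Bool), ρ.length = q.eval x.length →
      SamplesWithin
        ((Code.seq c₀ (.seq (.while t c) c₁)).run O (p.eval x.length) (HasVal.enc (x, ρ)))
        ((iterateBind (oracleStep query upd O) (rounds x) (init (x, ρ))).map fin)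
        (p.eval x.length) by
    refine ⟨_, p, q, fun O x => ⟨fun ρ hρ => (hrun O x ρ hρ).2, pmf_bind_congr fun ρ hρ => ?_⟩⟩
    have hfst := congrArg (PMF.map Val.isTrue) (hrun O x ρ (mem_support_unif.1 hρ)).1
    rw [PMF.map_comp, PMF.map_comp] at hfst
    exact (PMF.map_id _).symm.trans hfst.symm
  intro O x ρ hρ
  set N := p.eval x.length with hN
  simp only [p, Polynomial.eval_add, Polynomial.eval_mul, Polynomial.eval_comp,
    Polynomial.eval_X, Polynomial.eval_ofNat] at hN
  have hrounds := Nat.mul_le_mul_right (pt.eval (S.eval x.length) + pc.eval (S.eval x.length))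
    (hT x)
  have hT' := hT x
  have hinit := SamplesWithin.of_forall_eval h₀ O (N := N) (a := (x, ρ))
    (B := 2 * x.length + 2 * q.eval x.length + 3) (by omega)
    (by rw [inputSize_pair, inputSize_bits, inputSize_bits, hρ]; omega)
  have hloop : SamplesWithin ((Code.while t c).run O N (HasVal.enc (init (x, ρ)))) _ _ :=
    (hI O x).whileLoop (fun _ => .of_forall_eval ht O (by omega))
      (fun s hs => have hs' := polynomial_eval_le_eval pc hs
        (hc O N s (by omega)).mono hs')
      (by omega) (hstart x ρ hρ)
  have hfin := hloop.seq fun s hs => .of_forall_eval h₁ O (by omega)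
    ((hI O x).size _ _ ((hI O x).iterateBind (j := 0) (hstart x ρ hρ) s hs))
  exact (hinit.pure_seq hfin).mono (by omega)

end

/-! ### The function family and the reduction attached to a simulator -/

section

variable {α β γ : Type} [HasVal α] [HasVal β] [HasVal γ]

/-- One step of `index`, which reads a bit as long as the range `2 ^ d` of the number read so far is
less than `k`. The state is the pair of the range and the number. -/
def indexStep (k : ℕ) (a : ℕ × ℕ) (b : Bool) : ℕ × ℕ :=
  if decide (a.1 < k) then (2 * a.1, 2 * a.2 + if b then 1 else 0) else a

/-- An element of `{0, …, 2 ^ d - 1}`, where `2 ^ d` is the least power of two that is at least `k`,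
read off from the first `d` bits of the string. -/
def index (k : ℕ) (s : List Bool) : ℕ := (s.foldl (indexStep k) (1, 0)).2

lemma foldl_indexStep_bounds (k : ℕ) (s : List Bool) (a : ℕ × ℕ) (h : a.2 < a.1)
    (h' : a.1 ≤ 2 * k + 1) :
    (s.foldl (indexStep k) a).2 < (s.foldl (indexStep k) a).1 ∧
      (s.foldl (indexStep k) a).1 ≤ 2 * k + 1 := by
  induction s generalizing a with
  | nil => exact ⟨h, h'⟩
  | cons _ _ ih =>
    refine ih _ ?_ ?_ <;>
    · simp only [indexStep, decide_eq_true_eq]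
      split_ifs <;> omega

@[fun_prop]
lemma PolyTime.index {k : γ → ℕ} {s : γ → List Bool} (hk : PolyTime k) (hs : PolyTime s) :
    PolyTime fun c => index (k c) (s c) := by
  obtain ⟨p, hp⟩ := hk.exists_inputSize_le
  have hstep : PolyTime fun a : γ × (ℕ × ℕ) × Bool => indexStep (k a.1) a.2.1 a.2.2 := by
    unfold indexStep
    fun_prop
  refine (PolyTime.foldl (g := fun c => indexStep (k c)) hs (.const (1, 0)) hstep
    (8 * p + 12) fun c l _ => ?_).snd
  obtain ⟨hlt, hle⟩ := foldl_indexStep_bounds (k c) l (1, 0) (by simp) (by simp)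
  have hpc := hp c
  rw [inputSize_nat] at hpc
  rw [inputSize_pair, inputSize_nat, inputSize_nat]
  simp only [Polynomial.eval_add, Polynomial.eval_mul, Polynomial.eval_ofNat]
  omega

lemma enc_bool_injective : Function.Injective (HasVal.enc : Bool → Val) := fun _ _ => Val.atom.inj

lemma enc_prod_injective (hα : Function.Injective (HasVal.enc : α → Val))
    (hβ : Function.Injective (HasVal.enc : β → Val)) :
    Function.Injective (HasVal.enc : α × β → Val) := fun _ _ h =>
  Prod.ext (hα (Val.node.inj h).1) (hβ (Val.node.inj h).2)

lemma enc_list_injective (hα : Function.Injective (HasVal.enc : α → Val)) :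
    Function.Injective (HasVal.enc : List α → Val)
  | [], [], _ => rfl
  | [], _ :: _, h | _ :: _, [], h => by cases h
  | _ :: _, _ :: _, h =>
    congrArg₂ _ (hα (Val.node.inj h).1) (enc_list_injective hα (Val.node.inj h).2)

/-- A partial transcript followed by a string and a bit, written as a bit string of length `M`. -/
def serPartial (M : ℕ) (τ : Transcript) (r : List Bool) (b : Bool) : List Bool :=
  pad M (HasVal.enc (τ, r, b) : Val).ser

@[fun_prop]
lemma PolyTime.serPartial {M : γ → ℕ} {τ : γ → Transcript} {r : γ → List Bool} {b : γ → Bool}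
    (hM : PolyTime M) (hτ : PolyTime τ) (hr : PolyTime r) (hb : PolyTime b) :
    PolyTime fun c => serPartial (M c) (τ c) (r c) (b c) := by
  unfold PublicCoinZK.serPartial
  fun_prop

lemma serPartial_inj {M : ℕ} {τ τ' : Transcript} {r r' : List Bool} {b b' : Bool}
    (h : 2 * inputSize (τ, r, b) ≤ M) (h' : 2 * inputSize (τ', r', b') ≤ M)
    (heq : serPartial M τ r b = serPartial M τ' r' b') : τ = τ' ∧ r = r' ∧ b = b' := by
  rw [serPartial, serPartial, pad_of_length_le (by rw [Val.length_ser]; exact h),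
    pad_of_length_le (by rw [Val.length_ser]; exact h')] at heq
  have hbits := enc_list_injective enc_bool_injective
  simpa only [Prod.mk.injEq] using enc_prod_injective
    (enc_list_injective (enc_prod_injective hbits hbits))
    (enc_prod_injective hbits enc_bool_injective) (Val.ser_append_inj heq).1

/-- A simulator for the protocol `Γ` all of whose transcripts have the right number of rounds, with
bounds for the number of rounds and for the lengths of strings. -/
structure Simulator (Γ : Protocol) where
  /-- The output of the simulator as a function of the instance and the coins. -/
  sim : List Bool × List Bool → Transcript
  /-- The number of coins of the simulator. -/
  simCoins : Polynomial ℕ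
  /-- A bound on the number of rounds. -/
  indexLen : Polynomial ℕ
  /-- A bound on the number of coins of the verifier. -/
  verCoins : Polynomial ℕ
  /-- A bound on the length of serialized partial transcripts. -/
  serLen : Polynomial ℕ
  polyTime_sim : PolyTime sim
  polyTime_coins : PolyTime fun x : List Bool => Γ.coins x.length
  polyTime_verifier : PolyTime fun a : List Bool × Transcript => Γ.verifier a.1 a.2
  length_sim : ∀ a, (sim a).length = (Γ.coins a.1.length).length
  first_sim : ∀ a, (Γ.coins a.1.length).head? = some 0 → ((sim a).getD 0 ([], [])).1 = []
  rounds_le : ∀ x : List Bool, (Γ.coins x.length).length ≤ indexLen.eval x.length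
  sum_le : ∀ x : List Bool, (Γ.coins x.length).sum ≤ verCoins.eval x.length
  ser_le : ∀ x ρ : List Bool, ρ.length ≤ simCoins.eval x.length → ∀ (j : ℕ) (b : Bool),
    2 * inputSize ((sim (x, ρ)).take j, ((sim (x, ρ)).getD j ([], [])).1, b) ≤
      serLen.eval x.length

namespace Simulator

variable {Γ : Protocol} (D : Simulator Γ)

/-- The input length of the function family: the coins that choose a round, followed by the coins of
the simulator. -/
noncomputable def inLen : Polynomial ℕ := D.indexLen + D.simCoins

/-- The simulated transcript computed from an input of the function family. -/
noncomputable def transcript (x ρ : List Bool) : Transcript :=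
  D.sim (x, ρ.drop (D.indexLen.eval x.length))

/-- The round chosen by an input of the function family. -/
noncomputable def round (x ρ : List Bool) : ℕ :=
  index (Γ.coins x.length).length (ρ.take (D.indexLen.eval x.length))

variable (Γ) in
/-- The bit of the function value: acceptance in the last round and `true` in the others. -/
def bit (x : List Bool) (j : ℕ) (τ : Transcript) : Bool :=
  decide (j + 1 < (Γ.coins x.length).length) || Γ.verifier x τ

/-- The function family: simulate a transcript, and return the part before the prover's message in a
random round. -/
noncomputable def fn (x ρ : List Bool) : List Bool :=
  serPartial (D.serLen.eval x.length) ((D.transcript x ρ).take (D.round x ρ))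
    ((D.transcript x ρ).getD (D.round x ρ) ([], [])).1
    (bit Γ x (D.round x ρ) (D.transcript x ρ))

/-- The query of the cheating prover. -/
noncomputable def query (x : List Bool) (τ : Transcript) (r : List Bool) : List Bool :=
  serPartial (D.serLen.eval x.length) τ r true

/-- The message of the cheating prover, read off from the answer of the oracle. -/
noncomputable def message (x : List Bool) (τ : Transcript) (a : List Bool) : List Bool :=
  ((D.transcript x a).getD τ.length ([], [])).2

/-- The cheating prover. -/
noncomputable def prover (O : Oracle PMF) (x : List Bool) : Strategy := fun τ r =>
  (O (x, D.query x τ r)).map fun a => D.message x τ (a.take (D.inLen.eval x.length))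

/-- The reduction: run the protocol with the cheating prover. -/
noncomputable def reduction (O : Oracle PMF) (x : List Bool) : PMF Bool :=
  (Γ.view (D.prover O x) x).map (Γ.verifier x)

@[fun_prop]
lemma polyTime_transcript {x ρ : γ → List Bool} (hx : PolyTime x) (hρ : PolyTime ρ) :
    PolyTime fun c => D.transcript (x c) (ρ c) :=
  D.polyTime_sim.comp (by fun_prop)

@[fun_prop]
lemma polyTime_query {x r : γ → List Bool} {τ : γ → Transcript} (hx : PolyTime x)
    (hτ : PolyTime τ) (hr : PolyTime r) : PolyTime fun c => D.query (x c) (τ c) (r c) := by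
  unfold query
  fun_prop

@[fun_prop]
lemma polyTime_message {x a : γ → List Bool} {τ : γ → Transcript} (hx : PolyTime x)
    (hτ : PolyTime τ) (ha : PolyTime a) : PolyTime fun c => D.message (x c) (τ c) (a c) := by
  unfold message
  fun_prop

lemma isPolyTimeFamily_fn : IsPolyTimeFamily D.fn D.inLen D.serLen := by
  have hk : PolyTime fun a : List Bool × List Bool => Γ.coins a.1.length :=
    D.polyTime_coins.comp (by fun_prop)
  have hround : PolyTime fun a : List Bool × List Bool => D.round a.1 a.2 := by
    unfold round
    fun_prop
  have hverdict : PolyTime fun a : List Bool × List Bool =>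
      Γ.verifier a.1 (D.transcript a.1 a.2) :=
    D.polyTime_verifier.comp
      (f := fun a : List Bool × List Bool => (a.1, D.transcript a.1 a.2)) (by fun_prop)
  have hbit : PolyTime fun a : List Bool × List Bool =>
      bit Γ a.1 (D.round a.1 a.2) (D.transcript a.1 a.2) := by
    unfold bit
    fun_prop
  refine ⟨?_, fun _ _ _ => length_pad _ _⟩
  unfold fn
  fun_prop

/-- States of the reduction: the instance, the lengths of the remaining coins of the verifier, the
remaining random string, and the current transcript. -/
abbrev State : Type := List Bool × List ℕ × List Bool × Transcript

/-- The oracle call in a state of the reduction, in the format of `oracleStep`. -/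
noncomputable def stateQuery (s : State) : List Bool × List Bool × List Bool :=
  (List.replicate (D.inLen.eval s.1.length) true, s.1,
    D.query s.1 s.2.2.2 (s.2.2.1.take (s.2.1.headD 0)))

/-- The state of the reduction after the oracle has answered. -/
noncomputable def stateUpdate (a : State × List Bool) : State :=
  (a.1.1, a.1.2.1.tail, a.1.2.2.1.drop (a.1.2.1.headD 0),
    a.1.2.2.2 ++ [(a.1.2.2.1.take (a.1.2.1.headD 0), D.message a.1.1 a.1.2.2.2 a.2)])

/-- One round of the reduction. -/
noncomputable def step (O : Oracle PMF) : State → PMF State :=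
  oracleStep D.stateQuery D.stateUpdate O

lemma step_apply (O : Oracle PMF) (x : List Bool) (m : ℕ) (ms : List ℕ) (ρ : List Bool)
    (τ : Transcript) : D.step O (x, m :: ms, ρ, τ) = (D.prover O x τ (ρ.take m)).map fun π =>
      (x, ms, ρ.drop m, τ ++ [(ρ.take m, π)]) := by
  rw [step, oracleStep, prover, PMF.map_comp]
  simp only [stateQuery, List.length_replicate]
  rfl

lemma map_iterateBind_step_cons {β : Type} (O : Oracle PMF) (x r ρ : List Bool) (ms : List ℕ)
    (τ : Transcript) (F : State → β) :
    (iterateBind (D.step O) (ms.length + 1) (x, r.length :: ms, r ++ ρ, τ)).map F =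
      (D.prover O x τ r).bind fun π =>
        (iterateBind (D.step O) ms.length (x, ms, ρ, τ ++ [(r, π)])).map F := by
  rw [iterateBind, step_apply, PMF.bind_map, PMF.map_bind, List.take_left, List.drop_left]
  rfl

lemma bind_iterateBind_step {β : Type} (O : Oracle PMF) (x : List Bool) {ms : List ℕ} {Q : ℕ}
    (hQ : ms.sum ≤ Q) (τ : Transcript) (F : List Bool → Transcript → β) :
    ((unif Q).bind fun ρ => (iterateBind (D.step O) ms.length (x, ms, ρ, τ)).map
      fun s => F s.1 s.2.2.2) = (interact (D.prover O x) ms τ).map (F x) := by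
  induction ms generalizing Q τ with
  | nil => simp [iterateBind, interact, PMF.pure_map]
  | cons m ms ih =>
    rw [List.sum_cons] at hQ
    obtain ⟨Q, rfl⟩ := Nat.exists_eq_add_of_le ((Nat.le_add_right _ _).trans hQ)
    rw [unif_add, PMF.bind_bind, interact, PMF.map_bind]
    refine pmf_bind_congr fun u hu => ?_
    obtain rfl := mem_support_unif.1 hu
    simp only [PMF.bind_map, PMF.map_bind, Function.comp_def, List.length_cons,
      map_iterateBind_step_cons]
    rw [PMF.bind_comm]
    exact pmf_bind_congr fun π _ => ih (by omega) _

/-- The invariant of the loop of the reduction: `Z` bounds the sizes at the beginning and `E` the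
sizes of the rounds of the transcript. -/
def Inv (Z E : ℕ) (x : List Bool) (i : ℕ) (s : State) : Prop :=
  s.1 = x ∧ s.2.1.length = i ∧ inputSize s.2.1 ≤ Z ∧ s.2.2.1.length ≤ Z ∧
    s.2.2.2.length + i ≤ Z ∧ ∀ a ∈ s.2.2.2, inputSize a ≤ E

lemma Inv.inputSize_le {Z E i : ℕ} {x : List Bool} {s : State} (h : Inv Z E x i s)
    (hx : inputSize x ≤ Z) : inputSize s ≤ 5 * Z + Z * (E + 1) + 5 := by
  obtain ⟨y, ms, ρ, τ⟩ := s
  obtain ⟨rfl, -, hms, hρ, hτ, hE⟩ := h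
  dsimp only at hms hρ hτ hE hx
  rw [inputSize_pair, inputSize_pair, inputSize_pair, inputSize_bits ρ]
  have := inputSize_le_of_forall hE
  have : τ.length * (E + 1) ≤ Z * (E + 1) := Nat.mul_le_mul_right _ (by omega)
  omega

lemma inv_of_inputSize_le {Z E : ℕ} {s : State} (hZ : inputSize s ≤ Z) (hE : Z ≤ E) :
    Inv Z E s.1 s.2.1.length s := by
  obtain ⟨x, ms, ρ, τ⟩ := s
  rw [inputSize_pair, inputSize_pair, inputSize_pair, inputSize_bits ρ] at hZ
  have := length_le_inputSize ms
  have := length_le_inputSize τ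
  refine ⟨rfl, rfl, ?_, ?_, ?_, fun a ha => ?_⟩ <;> try dsimp only; omega
  have : inputSize a ≤ inputSize τ := inputSize_le_of_mem ha
  omega

lemma Inv.step {Z E M i : ℕ} {x : List Bool} {O : Oracle PMF} {s s' : State}
    (h : Inv Z E x (i + 1) s) (hs' : s' ∈ (D.step O s).support) (hE : 2 * Z + 2 * M + 3 ≤ E)
    (hM : ∀ τ, ∀ a : List Bool, a.length ≤ D.inLen.eval x.length → (D.message x τ a).length ≤ M) :
    Inv Z E x i s' := by
  obtain ⟨a, -, rfl⟩ := (PMF.mem_support_map_iff _ _ _).1 hs'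
  obtain ⟨y, _ | ⟨m, ms⟩, ρ, τ⟩ := s <;> obtain ⟨rfl, hi, hms, hρ, hτ, hround⟩ := h
  · exact absurd hi (Nat.succ_ne_zero i).symm
  have hmessage := hM τ (a.take (D.inLen.eval y.length)) (List.length_take_le _ _)
  dsimp only at hmessage
  simp only [List.length_cons, add_left_inj, inputSize_cons] at hi hms hρ hτ
  simp only [Inv, stateUpdate, stateQuery, List.length_replicate, List.tail_cons, List.headD_cons,
    List.length_drop, List.length_append, List.length_singleton, true_and]
  refine ⟨hi, by omega, by omega, by omega, fun b hb => ?_⟩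
  rcases List.mem_append.1 hb with hb | hb
  · exact hround b hb
  · rw [List.mem_singleton.1 hb, inputSize_pair, inputSize_bits, inputSize_bits, List.length_take]
    omega

lemma exists_length_message_le : ∃ M : Polynomial ℕ, ∀ x τ, ∀ a : List Bool,
    a.length ≤ D.inLen.eval x.length → (D.message x τ a).length ≤ M.eval x.length := by
  have htranscript : PolyTime fun a : List Bool × List Bool => D.transcript a.1 a.2 := by fun_prop
  obtain ⟨p, hp⟩ := htranscript.exists_inputSize_le
  refine ⟨p.comp (2 * .X + 2 * D.inLen + 3), fun x τ a ha => ?_⟩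
  have hmessage : (D.message x τ a).length ≤ inputSize (D.transcript x a) := by
    rw [message, List.getD_eq_getElem?_getD]
    cases hτ : (D.transcript x a)[τ.length]? with
    | none => exact Nat.zero_le _
    | some b =>
      exact ((length_le_inputSize b.2).trans (by rw [inputSize_pair]; omega)).trans
        (inputSize_le_of_mem (List.mem_of_getElem? hτ))
  refine hmessage.trans ((hp (x, a)).trans ?_)
  rw [Polynomial.eval_comp]
  refine polynomial_eval_le_eval p ?_
  simp only [inputSize_pair, inputSize_bits, Polynomial.eval_add, Polynomial.eval_mul,
    Polynomial.eval_X, Polynomial.eval_ofNat]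
  omega

lemma exists_loopInvariant : ∃ E S : Polynomial ℕ,
    (∀ O Z (x : List Bool), inputSize x ≤ Z →
      LoopInvariant (fun s : State => !s.2.1.isEmpty) (D.step O) (S.eval Z)
        (Inv Z (E.eval Z) x)) ∧
    ∀ Z (s : State), inputSize s ≤ Z → Inv Z (E.eval Z) s.1 s.2.1.length s := by
  obtain ⟨M, hM⟩ := D.exists_length_message_le
  let E : Polynomial ℕ := 2 * .X + 2 * M + 3
  have hE (Z : ℕ) : E.eval Z = 2 * Z + 2 * M.eval Z + 3 := by simp [E]
  refine ⟨E, 5 * .X + .X * (E + 1) + 5, fun O Z x hx => ?_,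
    fun Z s hs => inv_of_inputSize_le hs (by rw [hE]; omega)⟩
  refine ⟨fun i s hs => ?_, ?_, ?_, fun i s hs s' hs' => ?_⟩
  · simpa using hs.inputSize_le hx
  · rintro ⟨x', ms, ρ, τ⟩ ⟨-, hms, -⟩
    simpa using hms
  · rintro i ⟨x', _ | ⟨m, ms⟩, ρ, τ⟩ ⟨-, hms, -⟩
    · exact absurd hms (Nat.succ_ne_zero i).symm
    · rfl
  · exact hs.step D hs' (hE Z).ge fun τ a ha => (hM x τ a ha).trans <|
      polynomial_eval_le_eval M ((length_le_inputSize x).trans hx)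

lemma oraclePolyTime_reduction : OraclePolyTime D.reduction := by
  obtain ⟨E, S, hloop, hinit⟩ := D.exists_loopInvariant
  obtain ⟨p, hp⟩ := D.polyTime_coins.exists_inputSize_le
  let Z : Polynomial ℕ := 2 * .X + p.comp (2 * .X + 1) + 2 * D.verCoins + 6
  have hZ (x ρ : List Bool) (hρ : ρ.length = D.verCoins.eval x.length) :
      inputSize ((x, Γ.coins x.length, ρ, []) : State) ≤ Z.eval x.length := by
    have hcoins := hp x
    simp only [inputSize_pair, inputSize_bits, inputSize_nil, hρ, Z, Polynomial.eval_add,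
      Polynomial.eval_mul, Polynomial.eval_X, Polynomial.eval_ofNat, Polynomial.eval_one,
      Polynomial.eval_comp] at hcoins ⊢
    omega
  convert oraclePolyTime_loop (init := fun a : List Bool × List Bool =>
      ((a.1, Γ.coins a.1.length, a.2, []) : State)) (test := fun s : State => !s.2.1.isEmpty)
    (query := D.stateQuery) (upd := D.stateUpdate) (fin := fun s : State => Γ.verifier s.1 s.2.2.2)
    ?_ ?_ ?_ ?_ ?_ (fun x => (Γ.coins x.length).length) D.verCoins
    D.indexLen (S.comp Z) (fun x => Inv (Z.eval x.length) (E.eval (Z.eval x.length)) x)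
    D.rounds_le ?_ ?_ using 3 with O x
  · exact (D.bind_iterateBind_step O x (D.sum_le x) [] Γ.verifier).symm
  · have hcoins : PolyTime fun a : List Bool × List Bool => Γ.coins a.1.length :=
      D.polyTime_coins.comp (by fun_prop)
    fun_prop
  · fun_prop
  · unfold stateQuery; fun_prop
  · unfold stateUpdate; fun_prop
  · exact D.polyTime_verifier.comp (f := fun s : State => (s.1, s.2.2.2)) (by fun_prop)
  · intro O x
    rw [Polynomial.eval_comp]
    refine hloop O _ x ?_
    rw [inputSize_bits]
    simp only [Z, Polynomial.eval_add, Polynomial.eval_mul, Polynomial.eval_X,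
      Polynomial.eval_ofNat]
    omega
  · exact fun x ρ hρ => hinit _ _ (hZ x ρ hρ)

end Simulator

/-! ### Hybrids between the simulator and the cheating prover -/

lemma interact_append (P : Strategy) (ms ms' : List ℕ) (τ : Transcript) :
    interact P (ms ++ ms') τ = (interact P ms τ).bind (interact P ms') := by
  induction ms generalizing τ with
  | nil => rw [List.nil_append, interact, PMF.pure_bind]
  | cons m ms ih => simp only [List.cons_append, interact, PMF.bind_bind, ih]

lemma exists_append_of_mem_support_interact {P : Strategy} {ms : List ℕ} {τ τ' : Transcript}
    (h : τ' ∈ (interact P ms τ).support) :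
    ∃ τ₁, τ' = τ ++ τ₁ ∧ τ₁.map (fun a => a.1.length) = ms := by
  induction ms generalizing τ with
  | nil =>
    rw [interact, PMF.mem_support_pure_iff] at h
    exact ⟨[], by rw [h, List.append_nil], rfl⟩
  | cons m ms ih =>
    simp only [interact, PMF.mem_support_bind_iff, mem_support_unif] at h
    obtain ⟨r, hr, π, -, h⟩ := h
    obtain ⟨τ₁, rfl, h₁⟩ := ih h
    exact ⟨(r, π) :: τ₁, by rw [List.append_assoc, List.singleton_append],
      by rw [List.map_cons, hr, h₁]⟩

lemma map_length_of_mem_support_view {Γ : Protocol} {P : Strategy} {x : List Bool} {τ : Transcript}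
    (h : τ ∈ (Γ.view P x).support) : τ.map (fun a => a.1.length) = Γ.coins x.length := by
  obtain ⟨τ₁, rfl, h⟩ := exists_append_of_mem_support_interact h
  exact h

/-- Truncate the first random string of a transcript to length `m`. -/
def trimFirst (m : ℕ) (τ : Transcript) : Transcript :=
  List.casesOn τ [] fun a l => (a.1.take m, a.2) :: l

/-- Force a transcript to have as many rounds as the list has entries, and force the length of the
first random string. Transcripts of the protocol are unchanged. -/
def normalize (ms : List ℕ) (τ : Transcript) : Transcript :=
  trimFirst (ms.headD 0) ((τ ++ List.replicate ms.length ([], [])).take ms.length)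

@[fun_prop]
lemma PolyTime.normalize {ms : γ → List ℕ} {τ : γ → Transcript} (hm : PolyTime ms)
    (hτ : PolyTime τ) : PolyTime fun c => normalize (ms c) (τ c) :=
  PolyTime.listCasesOn (h := fun c (a : List Bool × List Bool) l =>
    (a.1.take ((ms c).headD 0), a.2) :: l) (by fun_prop) (by fun_prop) (by fun_prop)

lemma length_normalize (ms : List ℕ) (τ : Transcript) : (normalize ms τ).length = ms.length := by
  have h (m : ℕ) (τ : Transcript) : (trimFirst m τ).length = τ.length := by cases τ <;> rfl
  simp [normalize, h]

lemma normalize_getD_zero {ms : List ℕ} (h : ms.head? = some 0) (τ : Transcript) :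
    ((normalize ms τ).getD 0 ([], [])).1 = [] := by
  have htrim (τ : Transcript) : ((trimFirst 0 τ).getD 0 ([], [])).1 = [] := by cases τ <;> rfl
  rw [normalize, List.headD_eq_head?_getD, h]
  exact htrim _

lemma normalize_eq_self {ms : List ℕ} {τ : Transcript} (h : τ.map (fun a => a.1.length) = ms) :
    normalize ms τ = τ := by
  subst h
  rw [normalize, List.take_append_of_le_length (by simp), List.take_of_length_le (by simp)]
  cases τ with
  | nil => rfl
  | cons a τ => simp [trimFirst]

lemma view_map_normalize (Γ : Protocol) (P : Strategy) (x : List Bool) :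
    (Γ.view P x).map (normalize (Γ.coins x.length)) = Γ.view P x :=
  (pmf_map_congr fun _ hτ => normalize_eq_self (map_length_of_mem_support_view hτ)).trans
    (PMF.map_id _)

lemma sum_le_inputSize (l : List ℕ) : l.sum ≤ inputSize l := by
  induction l with
  | nil => exact Nat.zero_le _
  | cons m l ih =>
    rw [List.sum_cons, inputSize_cons, inputSize_nat]
    omega

lemma inputSize_partial_le (τ : Transcript) (j : ℕ) (b : Bool) :
    inputSize (τ.take j, (τ.getD j ([], [])).1, b) ≤ 2 * inputSize τ + 3 := by
  have htake := inputSize_le_of_prefix (List.take_prefix j τ)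
  have hget : inputSize (τ.getD j ([], [])).1 ≤ inputSize τ := by
    rw [List.getD_eq_getElem?_getD]
    cases hj : τ[j]? with
    | none => exact one_le_inputSize τ
    | some a =>
      exact le_trans (by rw [Option.getD_some, inputSize_pair]; omega)
        (inputSize_le_of_mem (List.mem_of_getElem? hj))
  have hbit : inputSize b = 1 := rfl
  rw [inputSize_pair, inputSize_pair]
  omega

lemma exists_simulator {Γ : Protocol} (hΓ : Γ.EfficientVerifier) {Sim : List Bool → PMF Transcript}
    (hSim : PPT Sim) : ∃ D : Simulator Γ, ∀ x : List Bool,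
      (Sim x).map (normalize (Γ.coins x.length)) =
        (unif (D.simCoins.eval x.length)).map fun ρ => D.sim (x, ρ) := by
  obtain ⟨h, q, hh, hq⟩ := hSim
  have hcoins : PolyTime fun x : List Bool => Γ.coins x.length :=
    hΓ.1.of_enc_eq (fun x => x) (fun _ => rfl) fun x => by
      induction Γ.coins x.length with
      | nil => rfl
      | cons m l ih => exact congrArg (Val.node _) ih
  obtain ⟨p, hp⟩ := hcoins.exists_inputSize_le
  replace hp (x : List Bool) :
      inputSize (Γ.coins x.length) ≤ (p.comp (2 * .X + 1)).eval x.length := by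
    simpa [inputSize_bits] using hp x
  have hsim : PolyTime fun a : List Bool × List Bool => normalize (Γ.coins a.1.length) (h a) := by
    have : PolyTime fun a : List Bool × List Bool => Γ.coins a.1.length :=
      hcoins.comp (by fun_prop)
    fun_prop
  obtain ⟨r, hr⟩ := hsim.exists_inputSize_le
  refine ⟨⟨fun a => normalize (Γ.coins a.1.length) (h a), q.comp (2 * .X + 1),
    p.comp (2 * .X + 1), p.comp (2 * .X + 1),
    4 * r.comp (2 * .X + 2 * q.comp (2 * .X + 1) + 3) + 6, hsim, hcoins, hΓ.2,
    fun _ => length_normalize _ _, fun _ h0 => normalize_getD_zero h0 _,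
    fun x => (length_le_inputSize _).trans (hp x), fun x => (sum_le_inputSize _).trans (hp x),
    fun x ρ hρ j b => ?_⟩, fun x => ?_⟩
  · have hsize : inputSize (normalize (Γ.coins x.length) (h (x, ρ))) ≤ r.eval (inputSize (x, ρ)) :=
      hr (x, ρ)
    have hpartial := inputSize_partial_le (normalize (Γ.coins x.length) (h (x, ρ))) j b
    have hxρ : inputSize (x, ρ) ≤
        2 * x.length + 2 * (q.comp (2 * .X + 1)).eval x.length + 3 := by
      rw [inputSize_pair, inputSize_bits, inputSize_bits]
      omega
    have hmono := polynomial_eval_le_eval r hxρ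
    simp only [Polynomial.eval_add, Polynomial.eval_mul, Polynomial.eval_comp, Polynomial.eval_X,
      Polynomial.eval_one, Polynomial.eval_ofNat] at hmono ⊢
    omega
  · rw [hq, PMF.map_comp, inputSize_bits]
    simp only [Polynomial.eval_add, Polynomial.eval_mul, Polynomial.eval_comp, Polynomial.eval_X,
      Polynomial.eval_one, Polynomial.eval_ofNat]
    rfl

namespace Simulator

variable {Γ : Protocol} (D : Simulator Γ) {A : List Bool × List Bool → PMF (List Bool)}

lemma ppt_step (hA : PPT A) : PPT (D.step A) := by
  have hquery : PolyTime D.stateQuery := by unfold stateQuery; fun_prop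
  have hupdate : PolyTime D.stateUpdate := by unfold stateUpdate; fun_prop
  have htake : PolyTime fun a : State × List Bool =>
      D.stateUpdate (a.1, a.2.take (D.stateQuery a.1).1.length) := by fun_prop
  have hanswer : PPT fun s => A (D.stateQuery s).2 := hA.comp hquery.snd
  unfold step oracleStep
  exact hanswer.map htake

lemma ppt_prover (hA : PPT A) :
    PPT fun a : List Bool × Transcript × List Bool => D.prover A a.1 a.2.1 a.2.2 :=
  (hA.comp (f := fun a : List Bool × Transcript × List Bool => (a.1, D.query a.1 a.2.1 a.2.2))
    (by fun_prop)).map (f := fun (a : List Bool × Transcript × List Bool) (ans : List Bool) =>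
      D.message a.1 a.2.1 (ans.take (D.inLen.eval a.1.length))) (by fun_prop)

lemma exists_length_prover_le (O : Oracle PMF) : ∃ b : Polynomial ℕ,
    ∀ x τ r, ∀ π ∈ (D.prover O x τ r).support, π.length ≤ b.eval x.length := by
  obtain ⟨M, hM⟩ := D.exists_length_message_le
  refine ⟨M, fun x τ r π hπ => ?_⟩
  obtain ⟨a, -, rfl⟩ := (PMF.mem_support_map_iff _ _ _).1 hπ
  exact hM _ _ _ (List.length_take_le _ _)

/-- Whether the verifier accepts when the cheating prover takes over after `j` rounds. -/
noncomputable def before (O : Oracle PMF) (x : List Bool) (j : ℕ) (τ : Transcript) : PMF Bool :=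
  (interact (D.prover O x) ((Γ.coins x.length).drop j) (τ.take j)).map (Γ.verifier x)

/-- Whether the verifier accepts when the cheating prover takes over after `j` rounds and the next
random string of the verifier. -/
noncomputable def after (O : Oracle PMF) (x : List Bool) (j : ℕ) (τ : Transcript) : PMF Bool :=
  (D.prover O x (τ.take j) (τ.getD j ([], [])).1).bind fun π =>
    (interact (D.prover O x) ((Γ.coins x.length).drop (j + 1))
      (τ.take j ++ [((τ.getD j ([], [])).1, π)])).map (Γ.verifier x)

/-- Whether the verifier accepts the transcript, but does not accept in the test `after`. -/
noncomputable def afterRejects (O : Oracle PMF) (x : List Bool) (j : ℕ) (τ : Transcript) :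
    PMF Bool :=
  (D.after O x j τ).map fun b => Γ.verifier x τ && !b

lemma ppt_run (hA : PPT A) {s : γ × List Bool → State} (hs : PolyTime s) {Q : γ → ℕ}
    (hQ : PolyTime Q) : PPT fun c => (unif (Q c)).bind fun ρ =>
      (iterateBind (D.step A) (s (c, ρ)).2.1.length (s (c, ρ))).map fun s' =>
        Γ.verifier s'.1 s'.2.2.2 := by
  obtain ⟨E, S, hloop, hinit⟩ := D.exists_loopInvariant
  obtain ⟨p, hp⟩ := hs.exists_inputSize_le
  have hiter : PPT fun c => iterateBind (D.step A) (s c).2.1.length (s c) := by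
    refine PPT.iterateBind (K := fun _ => D.step A) ((D.ppt_step hA).comp (by fun_prop))
      (by fun_prop) hs (S.comp p) fun c i hi s' hs' => ?_
    obtain ⟨j, hj⟩ := Nat.exists_eq_add_of_le hi
    have hsize : inputSize (s c) = inputSize (s c).1 + inputSize (s c).2 + 1 := rfl
    have hx : inputSize (s c).1 ≤ p.eval (inputSize c) := by have := hp c; omega
    have hI := hloop A _ _ hx
    rw [Polynomial.eval_comp]
    exact hI.size _ _ (hI.iterateBind (hj ▸ hinit _ _ (hp c)) s' hs')
  exact (PPT.unif hQ).bind (hiter.map (f := fun _ s' => Γ.verifier s'.1 s'.2.2.2)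
    (D.polyTime_verifier.comp (f := fun a : (γ × List Bool) × State => (a.2.1, a.2.2.2.2))
      (by fun_prop)))

lemma sum_drop_coins_le (x : List Bool) (i : ℕ) :
    ((Γ.coins x.length).drop i).sum ≤ D.verCoins.eval x.length :=
  (List.Sublist.sum_le_sum (List.drop_sublist i _) fun _ _ => Nat.zero_le _).trans (D.sum_le x)

variable {x : γ → List Bool} {j : γ → ℕ} {τ : γ → Transcript}

lemma ppt_before (hA : PPT A) (hx : PolyTime x) (hj : PolyTime j) (hτ : PolyTime τ) :
    PPT fun c => D.before A (x c) (j c) (τ c) := by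
  have hcoins : PolyTime fun a : γ × List Bool => Γ.coins (x a.1).length :=
    D.polyTime_coins.comp (f := fun a : γ × List Bool => x a.1) (by fun_prop)
  convert D.ppt_run hA (s := fun a : γ × List Bool =>
      (x a.1, (Γ.coins (x a.1).length).drop (j a.1), a.2, (τ a.1).take (j a.1)))
    (by fun_prop) (Q := fun c => D.verCoins.eval (x c).length) (by fun_prop) using 2 with c
  exact (D.bind_iterateBind_step A _ (D.sum_drop_coins_le _ _) _ Γ.verifier).symm

lemma ppt_after (hA : PPT A) (hx : PolyTime x) (hj : PolyTime j) (hτ : PolyTime τ) :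
    PPT fun c => D.after A (x c) (j c) (τ c) := by
  have hcoins : PolyTime fun a : γ × List Bool => Γ.coins (x a.1).length :=
    D.polyTime_coins.comp (f := fun a : γ × List Bool => x a.1) (by fun_prop)
  convert D.ppt_run hA (s := fun a : γ × List Bool =>
      (x a.1, ((τ a.1).getD (j a.1) ([], [])).1.length ::
          (Γ.coins (x a.1).length).drop (j a.1 + 1),
        ((τ a.1).getD (j a.1) ([], [])).1 ++ a.2, (τ a.1).take (j a.1)))
    (by fun_prop) (Q := fun c => D.verCoins.eval (x c).length) (by fun_prop) using 2 with c
  simp only [List.length_cons, map_iterateBind_step_cons]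
  rw [PMF.bind_comm]
  exact pmf_bind_congr fun π _ =>
    (D.bind_iterateBind_step A _ (D.sum_drop_coins_le _ _) _ Γ.verifier).symm

lemma ppt_afterRejects (hA : PPT A) (hx : PolyTime x) (hj : PolyTime j) (hτ : PolyTime τ) :
    PPT fun c => D.afterRejects A (x c) (j c) (τ c) := by
  have hverifier : PolyTime fun a : γ × Bool => Γ.verifier (x a.1) (τ a.1) :=
    D.polyTime_verifier.comp (f := fun a : γ × Bool => (x a.1, τ a.1)) (by fun_prop)
  exact (D.ppt_after hA hx hj hτ).map (f := fun c b => Γ.verifier (x c) (τ c) && !b)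
    (by fun_prop)

end Simulator

end

/-! ### Probabilities of tests -/

section

variable {α : Type}

/-- The probability of the outcome `true`. -/
noncomputable def pr (p : PMF Bool) : ℝ := (p true).toReal

lemma pr_nonneg (p : PMF Bool) : 0 ≤ pr p := ENNReal.toReal_nonneg

lemma pr_le_one (p : PMF Bool) : pr p ≤ 1 :=
  ENNReal.toReal_le_of_le_ofReal zero_le_one (by simpa using p.coe_le_one true)

lemma pr_pure (b : Bool) : pr (PMF.pure b) = if b then 1 else 0 := by
  cases b <;> simp [pr, PMF.pure_apply]

lemma pr_pure_false : pr (PMF.pure false) = 0 := by simp [pr_pure]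

lemma hasSum_toReal_tsum {f : α → ENNReal} (h : ∑' a, f a ≠ ⊤) :
    HasSum (fun a => (f a).toReal) (∑' a, f a).toReal := by
  rw [ENNReal.tsum_toReal_eq (ENNReal.ne_top_of_tsum_ne_top h)]
  exact ENNReal.hasSum_toReal h

lemma hasSum_toReal_pmf (P : PMF α) : HasSum (fun a => (P a).toReal) 1 := by
  simpa only [P.tsum_coe, ENNReal.toReal_one] using
    hasSum_toReal_tsum (P.tsum_coe.trans_ne ENNReal.one_ne_top)

lemma hasSum_pr_bind (P : PMF α) (g : α → PMF Bool) :
    HasSum (fun a => (P a).toReal * pr (g a)) (pr (P.bind g)) := by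
  have h := (P.bind g).apply_ne_top true
  rw [PMF.bind_apply] at h
  simpa only [pr, PMF.bind_apply, ENNReal.toReal_mul] using hasSum_toReal_tsum h

lemma pr_bind_mono {P : PMF α} {g g' : α → PMF Bool}
    (h : ∀ a ∈ P.support, pr (g a) ≤ pr (g' a)) : pr (P.bind g) ≤ pr (P.bind g') := by
  refine hasSum_le (fun a => ?_) (hasSum_pr_bind P g) (hasSum_pr_bind P g')
  by_cases ha : P a = 0
  · simp [ha]
  · exact mul_le_mul_of_nonneg_left (h a ((P.mem_support_iff a).2 ha)) ENNReal.toReal_nonneg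

lemma pr_bind_add {P : PMF α} {g g₁ g₂ : α → PMF Bool} (h : ∀ a, pr (g a) = pr (g₁ a) + pr (g₂ a)) :
    pr (P.bind g) = pr (P.bind g₁) + pr (P.bind g₂) :=
  (hasSum_pr_bind P g).unique <| by
    simpa only [h, mul_add] using (hasSum_pr_bind P g₁).add (hasSum_pr_bind P g₂)

lemma pr_bind_le_add {P : PMF α} {g g₁ g₂ : α → PMF Bool}
    (h : ∀ a, pr (g a) ≤ pr (g₁ a) + pr (g₂ a)) :
    pr (P.bind g) ≤ pr (P.bind g₁) + pr (P.bind g₂) :=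
  hasSum_le (fun a => (mul_le_mul_of_nonneg_left (h a) ENNReal.toReal_nonneg).trans_eq
      (mul_add _ _ _))
    (hasSum_pr_bind P g) ((hasSum_pr_bind P g₁).add (hasSum_pr_bind P g₂))

lemma pr_bind_eq_mul_sum {W : PMF ℕ} {g : ℕ → PMF Bool} {k : ℕ} {w : ℝ}
    (hW : ∀ j < k, (W j).toReal = w) (hg : ∀ j, k ≤ j → pr (g j) = 0) :
    pr (W.bind g) = w * ∑ j ∈ Finset.range k, pr (g j) := by
  refine (hasSum_pr_bind W g).unique ?_
  have hsum : w * ∑ j ∈ Finset.range k, pr (g j) =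
      ∑ j ∈ Finset.range k, (W j).toReal * pr (g j) := by
    rw [Finset.mul_sum]
    exact Finset.sum_congr rfl fun j hj => by rw [hW j (Finset.mem_range.1 hj)]
  rw [hsum]
  exact hasSum_sum_of_ne_finset_zero fun j hj => by rw [hg j (by simpa using hj), mul_zero]

lemma statDist_nonneg (P Q : PMF α) : 0 ≤ statDist P Q :=
  mul_nonneg (by norm_num) (tsum_nonneg fun _ => abs_nonneg _)

lemma pr_bind_le_statDist (P Q : PMF α) (g : α → PMF Bool) :
    pr (P.bind g) ≤ pr (Q.bind g) + statDist P Q := by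
  have hdiff : HasSum (fun a => (P a).toReal - (Q a).toReal) 0 := by
    simpa using (hasSum_toReal_pmf P).sub (hasSum_toReal_pmf Q)
  -- `p ≤ 1` gives `d * p ≤ max d 0 = (|d| + d) / 2`, and the differences `d` have sum `0`.
  have hle := hasSum_le (fun a => ?_) ((hasSum_pr_bind P g).sub (hasSum_pr_bind Q g))
    ((hdiff.summable.abs.hasSum.add hdiff).mul_left (1 / 2))
  · rw [statDist]
    linarith
  · rw [← sub_mul]
    have h0 := pr_nonneg (g a)
    have h1 := pr_le_one (g a)
    rcases abs_cases ((P a).toReal - (Q a).toReal) with ⟨h, h'⟩ | ⟨h, h'⟩ <;> rw [h] <;> nlinarith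

/-! ### The distribution of the random round -/

lemma unif_one_bind_apply (g : List Bool → PMF α) (a : α) :
    ((unif 1).bind g) a = 2⁻¹ * g [false] a + 2⁻¹ * g [true] a := by
  rw [PMF.bind_apply, tsum_eq_sum (s := {[false], [true]}) fun l hl => ?_,
    Finset.sum_pair (by simp)]
  · simp [unif_apply]
  · rw [unif_apply, if_neg, zero_mul]
    rw [List.length_eq_one_iff]
    rintro ⟨b, rfl⟩
    cases b <;> simp at hl

lemma map_foldl_indexStep_apply {k d m N : ℕ} (a j : ℕ) (hd : d ≤ m) (hk : k ≤ N * 2 ^ d)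
    (hlt : ∀ e < d, N * 2 ^ e < k) :
    ((unif m).map fun s => (s.foldl (indexStep k) (N, a)).2) j =
      if j / 2 ^ d = a then (2 ^ d)⁻¹ else 0 := by
  induction d generalizing m N a with
  | zero =>
    have hstep (s : List Bool) : s.foldl (indexStep k) (N, a) = (N, a) := by
      induction s with
      | nil => rfl
      | cons b s ih => simpa [indexStep, show ¬N < k by simpa using hk] using ih
    simp only [hstep]
    rw [show (fun _ : List Bool => a) = Function.const _ a from rfl, PMF.map_const]
    simp [PMF.pure_apply]
  | succ d ih =>
    obtain ⟨m, rfl⟩ := Nat.exists_eq_add_of_le' (Nat.one_le_of_lt hd)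
    have hN : N < k := by simpa using hlt 0 d.succ_pos
    have hhalf (b : ℕ) := ih (m := m) (N := 2 * N) b (by omega) (by rw [pow_succ] at hk; linarith)
      fun e he => by have := hlt (e + 1) (by omega); rw [pow_succ] at this; linarith
    have hfirst (b : Bool) (s : List Bool) : (([b] ++ s).foldl (indexStep k) (N, a)) =
        s.foldl (indexStep k) (2 * N, 2 * a + if b then 1 else 0) := by
      simp [indexStep, hN]
    rw [add_comm m, unif_add, PMF.map_bind, unif_one_bind_apply]
    simp only [PMF.map_comp, Function.comp_def, hfirst, hhalf, Bool.false_eq_true, if_true,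
      if_false, add_zero, pow_succ, ← Nat.div_div_eq_div_mul]
    rw [ENNReal.mul_inv (by simp) (by simp), mul_comm _ (2 : ENNReal)⁻¹]
    split_ifs <;> first | omega | simp

lemma map_index_apply {k m j : ℕ} (hm : k ≤ m) (hj : j < k) :
    ((unif m).map (index k)) j = (2 ^ Nat.clog 2 k)⁻¹ := by
  have hclog : k ≤ 2 ^ Nat.clog 2 k := Nat.le_pow_clog one_lt_two k
  refine (map_foldl_indexStep_apply 0 j ((Nat.clog_le_of_le_pow k.lt_two_pow_self.le).trans hm)
    (by rwa [one_mul]) fun e he => ?_).trans (if_pos (Nat.div_eq_of_lt (hj.trans_le hclog)))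
  rw [one_mul]
  exact Nat.pow_lt_of_lt_clog he

lemma two_pow_clog_le {k t : ℕ} (hk : 1 ≤ k) (ht : 2 * k ≤ t + 1) : 2 ^ Nat.clog 2 k ≤ t := by
  rcases hd : Nat.clog 2 k with _ | d
  · omega
  · have : 2 ^ d < k := Nat.pow_lt_of_lt_clog (by omega)
    rw [pow_succ]
    omega

end

namespace Simulator

variable {Γ : Protocol} (D : Simulator Γ)

/-- The distribution of simulated transcripts. -/
noncomputable def dist (x : List Bool) : PMF Transcript :=
  (unif (D.simCoins.eval x.length)).map fun ρ => D.sim (x, ρ)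

lemma length_transcript (x ρ : List Bool) :
    (D.transcript x ρ).length = (Γ.coins x.length).length :=
  D.length_sim _

lemma pr_bind_round (x : List Bool) (G : ℕ → Transcript → PMF Bool) :
    pr ((unif (D.inLen.eval x.length)).bind fun ρ =>
      if D.round x ρ < (Γ.coins x.length).length then G (D.round x ρ) (D.transcript x ρ)
      else PMF.pure false) =
    ((2 : ℝ) ^ Nat.clog 2 (Γ.coins x.length).length)⁻¹ *
      ∑ j ∈ Finset.range (Γ.coins x.length).length, pr ((D.dist x).bind (G j)) := by
  set k := (Γ.coins x.length).length
  have hindep : ((unif (D.inLen.eval x.length)).bind fun ρ =>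
      if D.round x ρ < k then G (D.round x ρ) (D.transcript x ρ) else PMF.pure false) =
      ((unif (D.indexLen.eval x.length)).map (index k)).bind fun j =>
        (D.dist x).bind fun τ => if j < k then G j τ else PMF.pure false := by
    rw [inLen, Polynomial.eval_add, unif_add, PMF.bind_bind, PMF.bind_map]
    refine pmf_bind_congr fun u hu => ?_
    rw [mem_support_unif] at hu
    simp only [dist, PMF.bind_map, Function.comp_def, round, transcript, ← hu, List.take_left,
      List.drop_left, k]
  rw [hindep, pr_bind_eq_mul_sum (k := k) (fun j hj => by rw [map_index_apply (D.rounds_le x) hj])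
    fun j hj => by rw [funext fun τ => if_neg hj.not_gt, PMF.bind_const, pr_pure_false]]
  rw [ENNReal.toReal_inv, ENNReal.toReal_pow, ENNReal.toReal_ofNat]
  exact congrArg _ <| Finset.sum_congr rfl fun j hj => by simp only [Finset.mem_range.1 hj, if_true]

lemma length_drop_le {x ρ : List Bool} (hρ : ρ.length ≤ D.inLen.eval x.length) :
    (ρ.drop (D.indexLen.eval x.length)).length ≤ D.simCoins.eval x.length := by
  rw [inLen, Polynomial.eval_add] at hρ
  rw [List.length_drop]
  omega

lemma fn_inj {x ρ ρ' : List Bool} (hρ : ρ.length ≤ D.inLen.eval x.length)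
    (hρ' : ρ'.length ≤ D.inLen.eval x.length) (hj : D.round x ρ' < (Γ.coins x.length).length)
    (h : D.fn x ρ' = D.fn x ρ) :
    D.round x ρ' = D.round x ρ ∧
      (D.transcript x ρ').take (D.round x ρ) = (D.transcript x ρ).take (D.round x ρ) ∧
      ((D.transcript x ρ').getD (D.round x ρ) ([], [])).1 =
        ((D.transcript x ρ).getD (D.round x ρ) ([], [])).1 ∧
      bit Γ x (D.round x ρ) (D.transcript x ρ') = bit Γ x (D.round x ρ) (D.transcript x ρ) := by
  obtain ⟨htake, hget, hbit⟩ := serPartial_inj (D.ser_le x _ (D.length_drop_le hρ') _ _)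
    (D.ser_le x _ (D.length_drop_le hρ) _ _) h
  have hround : D.round x ρ' = D.round x ρ := by
    have := congrArg List.length htake
    simp only [List.length_take, D.length_sim] at this
    omega
  rw [hround] at htake hget hbit
  exact ⟨hround, htake, hget, hbit⟩

/-- The test `after`, restricted in the last round to accepting transcripts. -/
noncomputable def afterBit (O : Oracle PMF) (x : List Bool) (j : ℕ) (τ : Transcript) : PMF Bool :=
  if bit Γ x j τ then D.after O x j τ else PMF.pure false

lemma before_length (O : Oracle PMF) (x : List Bool) {τ : Transcript}
    (h : τ.length = (Γ.coins x.length).length) :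
    D.before O x (Γ.coins x.length).length τ = PMF.pure (Γ.verifier x τ) := by
  rw [before, List.drop_length, ← h, List.take_length, interact, PMF.pure_map]

lemma take_getD_append {τ : Transcript} {j : ℕ} (h : j < τ.length) :
    τ.take (j + 1) = τ.take j ++ [τ.getD j ([], [])] := by
  rw [List.take_add_one, List.getD_eq_getElem?_getD, List.getElem?_eq_getElem h]
  rfl

/-- Whether the verifier accepts when the cheating prover takes over after the message of the
prover in the round chosen by an input of the function family. -/
noncomputable def beforeNext (O : Oracle PMF) (x ρ : List Bool) : PMF Bool :=
  if D.round x ρ < (Γ.coins x.length).length then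
    D.before O x (D.round x ρ + 1) (D.transcript x ρ)
  else PMF.pure false

variable {D}

lemma beforeNext_of_bit_eq_false {O : Oracle PMF} {x ρ : List Bool}
    (h : bit Γ x (D.round x ρ) (D.transcript x ρ) = false) :
    D.beforeNext O x ρ = PMF.pure false := by
  rw [bit, Bool.or_eq_false_iff, decide_eq_false_iff_not] at h
  rw [beforeNext]
  split_ifs with hj
  · rw [show D.round x ρ + 1 = (Γ.coins x.length).length by omega,
      D.before_length O x (D.length_transcript _ _), h.2]
  · rfl

lemma beforeNext_of_fn_eq {O : Oracle PMF} {x ρ ρ' : List Bool}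
    (hρ : ρ.length ≤ D.inLen.eval x.length) (hρ' : ρ'.length ≤ D.inLen.eval x.length)
    (hj : D.round x ρ' < (Γ.coins x.length).length) (h : D.fn x ρ' = D.fn x ρ) :
    D.beforeNext O x ρ' =
      (interact (D.prover O x) ((Γ.coins x.length).drop (D.round x ρ + 1))
        ((D.transcript x ρ).take (D.round x ρ) ++
          [(((D.transcript x ρ).getD (D.round x ρ) ([], [])).1,
            D.message x ((D.transcript x ρ).take (D.round x ρ)) ρ')])).map (Γ.verifier x) := by
  obtain ⟨hround, htake, hget, -⟩ := D.fn_inj hρ hρ' hj h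
  rw [beforeNext, if_pos hj, before, hround,
    take_getD_append (by rwa [D.length_transcript, ← hround]),
    htake, ← hget, message, List.length_take, D.length_transcript, min_eq_left (hround ▸ hj.le)]

variable (D) in
/-- The test that is applied to the pair of an input of the function family and a function value:
the input is a preimage, and `beforeNext` succeeds. -/
noncomputable def preimageTest (O : Oracle PMF) (x : List Bool) (a : List Bool × List Bool) :
    PMF Bool :=
  if D.fn x (a.1.take (D.inLen.eval x.length)) = a.2 then
    D.beforeNext O x (a.1.take (D.inLen.eval x.length))
  else PMF.pure false

lemma preimageTest_of_not {O : Oracle PMF} {x ρ ρ' : List Bool}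
    (hρ : ρ.length ≤ D.inLen.eval x.length)
    (h : ¬(D.round x ρ < (Γ.coins x.length).length ∧
      bit Γ x (D.round x ρ) (D.transcript x ρ) = true)) :
    D.preimageTest O x (ρ', D.fn x ρ) = PMF.pure false := by
  rw [preimageTest]
  split_ifs with hfn
  · by_cases hj : D.round x (ρ'.take (D.inLen.eval x.length)) < (Γ.coins x.length).length
    · obtain ⟨hround, -, -, hbit⟩ := D.fn_inj hρ (List.length_take_le _ _) hj hfn
      rw [hround] at hj
      refine beforeNext_of_bit_eq_false ?_
      rw [hround, hbit]
      simpa [hj] using h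
    · exact if_neg hj
  · rfl

lemma pr_inverter_le {A : Oracle PMF} {x ρ : List Bool}
    (hρ : ρ.length ≤ D.inLen.eval x.length) :
    pr ((A (x, D.fn x ρ)).bind fun ρ' => D.preimageTest A x (ρ', D.fn x ρ)) ≤
      pr (if D.round x ρ < (Γ.coins x.length).length then
        D.afterBit A x (D.round x ρ) (D.transcript x ρ) else PMF.pure false) := by
  by_cases hgood : D.round x ρ < (Γ.coins x.length).length ∧
    bit Γ x (D.round x ρ) (D.transcript x ρ) = true
  · have hquery : D.query x ((D.transcript x ρ).take (D.round x ρ))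
        ((D.transcript x ρ).getD (D.round x ρ) ([], [])).1 = D.fn x ρ := by
      rw [fn, query, hgood.2]
    rw [if_pos hgood.1, afterBit, if_pos hgood.2, after, prover, hquery, PMF.bind_map]
    refine pr_bind_mono fun ρ' _ => ?_
    rw [preimageTest]
    split_ifs with hfn
    · by_cases hj : D.round x (ρ'.take (D.inLen.eval x.length)) < (Γ.coins x.length).length
      · exact (congrArg pr (beforeNext_of_fn_eq hρ (List.length_take_le _ _) hj hfn)).le
      · rw [beforeNext, if_neg hj, pr_pure_false]
        exact pr_nonneg _
    · rw [pr_pure_false]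
      exact pr_nonneg _
  · simp only [preimageTest_of_not hρ hgood, PMF.bind_const, pr_pure_false]
    exact pr_nonneg _

lemma sum_gap_le {A : Oracle PMF} {x : List Bool} {t : ℕ} {δ : ℝ}
    (hk : 1 ≤ (Γ.coins x.length).length) (ht : 2 * (Γ.coins x.length).length ≤ t + 1)
    (hA : DistInverts A D.fn x (D.inLen.eval x.length) δ) :
    ∑ j ∈ Finset.range (Γ.coins x.length).length,
      (pr ((D.dist x).bind (D.before A x (j + 1))) - pr ((D.dist x).bind (D.afterBit A x j))) ≤
      t * δ := by
  have hbefore : ((unif (D.inLen.eval x.length)).map fun ρ => (ρ, D.fn x ρ)).bind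
      (D.preimageTest A x) = (unif (D.inLen.eval x.length)).bind (D.beforeNext A x) := by
    rw [PMF.bind_map]
    refine pmf_bind_congr fun ρ hρ => ?_
    rw [Function.comp_apply, preimageTest, List.take_of_length_le (mem_support_unif.1 hρ).le,
      if_pos rfl]
  have hafter := pr_bind_mono (P := unif (D.inLen.eval x.length)) fun ρ hρ =>
    pr_inverter_le (A := A) (D := D) (mem_support_unif.1 hρ).le
  have hinv := (pr_bind_le_statDist _ _ (D.preimageTest A x)).trans (add_le_add le_rfl hA)
  simp only [hbefore, PMF.bind_bind, PMF.bind_map, Function.comp_def] at hinv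
  have hδ := hinv.trans (add_le_add_left hafter δ)
  unfold beforeNext at hδ
  rw [D.pr_bind_round x fun j => D.before A x (j + 1), D.pr_bind_round, ← sub_le_iff_le_add',
    ← mul_sub, ← Finset.sum_sub_distrib, inv_mul_le_iff₀ (by positivity)] at hδ
  have hδ0 : 0 ≤ δ := (statDist_nonneg _ _).trans hA
  exact hδ.trans (mul_le_mul_of_nonneg_right (by exact_mod_cast two_pow_clog_le hk ht) hδ0)

variable (D)

lemma view_bind_before (O : Oracle PMF) (P : Strategy) (x : List Bool) {j : ℕ}
    (hj : j < (Γ.coins x.length).length) :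
    (Γ.view P x).bind (D.before O x j) = (Γ.view P x).bind (D.after O x j) := by
  have hsplit : Γ.view P x = (interact P ((Γ.coins x.length).take j) []).bind
      (interact P ((Γ.coins x.length).drop j)) := by
    rw [Protocol.view, ← interact_append, List.take_append_drop]
  rw [hsplit, PMF.bind_bind, PMF.bind_bind]
  refine pmf_bind_congr fun τ hτ => ?_
  have hlen : τ.length = j := by
    obtain ⟨τ₁, rfl, h⟩ := exists_append_of_mem_support_interact hτ
    have := congrArg List.length h
    rw [List.length_map, List.length_take, min_eq_left hj.le] at this
    simpa using this
  have hbefore : (interact P ((Γ.coins x.length).drop j) τ).bind (D.before O x j) =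
      (interact (D.prover O x) ((Γ.coins x.length).drop j) τ).map (Γ.verifier x) := by
    rw [← PMF.bind_const (interact P ((Γ.coins x.length).drop j) τ) (PMF.map _ _)]
    refine pmf_bind_congr fun τ' hτ' => ?_
    obtain ⟨τ₁, rfl, -⟩ := exists_append_of_mem_support_interact hτ'
    rw [before, ← hlen, List.take_left]
  rw [hbefore, List.drop_eq_getElem_cons hj, interact, interact, PMF.map_bind, PMF.bind_bind]
  refine pmf_bind_congr fun r _ => ?_
  rw [PMF.bind_bind, ← PMF.bind_const (P τ r) (PMF.map _ _)]
  refine pmf_bind_congr fun π _ => ?_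
  rw [← PMF.bind_const (interact P ((Γ.coins x.length).drop (j + 1)) (τ ++ [(r, π)])) (PMF.map _ _)]
  refine pmf_bind_congr fun τ' hτ' => ?_
  obtain ⟨τ₁, rfl, -⟩ := exists_append_of_mem_support_interact hτ'
  have htake : (τ ++ [(r, π)] ++ τ₁).take j = τ := by
    rw [List.append_assoc, ← hlen, List.take_left]
  have hget : ((τ ++ [(r, π)] ++ τ₁).getD j ([], [])).1 = r := by
    rw [List.append_assoc, ← hlen, List.getD_eq_getElem?_getD]
    simp
  rw [after, htake, hget, PMF.map_bind]

end Simulator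

/-! ### The hybrid argument -/

lemma eventually_forall_mem_of_forall_selection {ι β : Type} {l : Filter ι} {s : ι → Set β}
    (hs : ∀ i, (s i).Nonempty) {Φ : ι → β → Prop}
    (h : ∀ f : ι → β, (∀ i, f i ∈ s i) → ∀ᶠ i in l, Φ i (f i)) :
    ∀ᶠ i in l, ∀ b ∈ s i, Φ i b := by
  have hworst : ∀ i, ∃ b ∈ s i, Φ i b → ∀ b' ∈ s i, Φ i b' := fun i => by
    by_cases hi : ∀ b ∈ s i, Φ i b
    · exact ⟨(hs i).some, (hs i).some_mem, fun _ => hi⟩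
    · push Not at hi
      obtain ⟨b, hb, hΦ⟩ := hi
      exact ⟨b, hb, fun hb' => absurd hb' hΦ⟩
  choose f hf hworst using hworst
  exact (h f hf).mono hworst

lemma pr_map_not (p : PMF Bool) : pr (p.map not) = 1 - pr p := by
  have hsum := (hasSum_toReal_pmf p).tsum_eq
  have hnot : (p.map not) true = p false := by
    rw [PMF.map_apply, tsum_bool]
    simp
  rw [tsum_bool] at hsum
  rw [pr, hnot, pr]
  linarith

/-- The advantage of the test `g` in distinguishing `P` from `Q`. -/
noncomputable def advantage {α : Type} (P Q : PMF α) (g : α → PMF Bool) : ℝ :=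
  |pr (P.bind g) - pr (Q.bind g)|

/-- No non-uniform probabilistic polynomial-time test has an advantage of more than `ε` in
distinguishing `Sim x` from the view of the honest execution: the condition on the simulator in
`Protocol.ZeroKnowledge`. -/
def Protocol.Simulates (Γ : Protocol) (Rel : List Bool → List Bool → Prop) (ε : ℕ → ℝ)
    (Sim : List Bool → PMF Transcript) : Prop :=
  ∀ T : List Bool × List Bool × Transcript → PMF Bool, PPT T →
    ∀ z : ℕ → List Bool, (∃ b : Polynomial ℕ, ∀ n, (z n).length ≤ b.eval n) →
    ∀ᶠ n in Filter.atTop, ∀ x w : List Bool, x.length = n → Rel x w →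
      advantage (Sim x) (Γ.view (Γ.prover x w) x) (fun τ => T (z n, x, τ)) ≤ ε n

namespace Simulator

variable {Γ : Protocol} (D : Simulator Γ)

lemma eventually_advantage_le {Rel : List Bool → List Bool → Prop} {ε : ℕ → ℝ}
    {Sim : List Bool → PMF Transcript}
    (hSim : ∀ x : List Bool, (Sim x).map (normalize (Γ.coins x.length)) = D.dist x)
    (hZK : Γ.Simulates Rel ε Sim)
    {T : List Bool → ℕ → Transcript → PMF Bool}
    (hT : PPT fun a : List Bool × List Bool × Transcript =>
      T a.2.1 a.1.length (normalize (Γ.coins a.2.1.length) a.2.2)) :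
    ∀ᶠ n in Filter.atTop, ∀ x w : List Bool, x.length = n → Rel x w →
      ∀ j ≤ (Γ.coins n).length,
        advantage (D.dist x) (Γ.view (Γ.prover x w) x) (T x j) ≤ ε n := by
  -- A non-uniform distinguisher learns the round `j` of the test from the length of its advice.
  filter_upwards [eventually_forall_mem_of_forall_selection
    (s := fun n => {z : List Bool | z.length ≤ D.indexLen.eval n}) (fun _ => ⟨[], Nat.zero_le _⟩)
    (Φ := fun n z => ∀ x w : List Bool, x.length = n → Rel x w →
      advantage (Sim x) (Γ.view (Γ.prover x w) x) (fun τ =>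
        T x z.length (normalize (Γ.coins x.length) τ)) ≤ ε n)
    fun z hz => hZK _ hT z ⟨D.indexLen, hz⟩] with n hn x w hx hw j hj
  have hlen : (List.replicate j true).length ≤ D.indexLen.eval n := by
    rw [List.length_replicate]
    exact hj.trans (hx ▸ D.rounds_le x)
  rw [advantage, ← hSim x, ← view_map_normalize Γ (Γ.prover x w) x, PMF.bind_map, PMF.bind_map]
  simpa only [advantage, List.length_replicate, Function.comp_def] using hn _ hlen x w hx hw

/-- Simulated transcripts and transcripts distributed according to `V` are `ε`-indistinguishable for
the tests that replace the prover from some round on by the cheating prover. -/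
structure HybridsIndist (A : Oracle PMF) (x : List Bool) (V : PMF Transcript) (ε : ℝ) : Prop where
  before : ∀ j ≤ (Γ.coins x.length).length, advantage (D.dist x) V (D.before A x j) ≤ ε
  after : ∀ j ≤ (Γ.coins x.length).length, advantage (D.dist x) V (D.after A x j) ≤ ε
  afterRejects : ∀ j ≤ (Γ.coins x.length).length,
    advantage (D.dist x) V (D.afterRejects A x j) ≤ ε

lemma eventually_hybridsIndist {Rel : List Bool → List Bool → Prop} {ε : ℕ → ℝ}
    {Sim : List Bool → PMF Transcript}
    (hSim : ∀ x : List Bool, (Sim x).map (normalize (Γ.coins x.length)) = D.dist x)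
    (hZK : Γ.Simulates Rel ε Sim)
    {A : List Bool × List Bool → PMF (List Bool)} (hA : PPT A) :
    ∀ᶠ n in Filter.atTop, ∀ x w : List Bool, x.length = n → Rel x w →
      D.HybridsIndist A x (Γ.view (Γ.prover x w) x) (ε n) := by
  have hx : PolyTime fun a : List Bool × List Bool × Transcript => a.2.1 := by fun_prop
  have hj : PolyTime fun a : List Bool × List Bool × Transcript => a.1.length := by fun_prop
  have hτ : PolyTime fun a : List Bool × List Bool × Transcript =>
      normalize (Γ.coins a.2.1.length) a.2.2 := by
    have hcoins : PolyTime fun a : List Bool × List Bool × Transcript => Γ.coins a.2.1.length :=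
      D.polyTime_coins.comp hx
    fun_prop
  filter_upwards [D.eventually_advantage_le hSim hZK (T := D.before A) (D.ppt_before hA hx hj hτ),
    D.eventually_advantage_le hSim hZK (T := D.after A) (D.ppt_after hA hx hj hτ),
    D.eventually_advantage_le hSim hZK (T := D.afterRejects A) (D.ppt_afterRejects hA hx hj hτ)]
    with n hbefore hafter hrejects x w hn hw
  subst hn
  exact ⟨hbefore x w rfl hw, hafter x w rfl hw, hrejects x w rfl hw⟩

lemma pr_afterRejects (O : Oracle PMF) (x : List Bool) (j : ℕ) (τ : Transcript) :
    pr (D.afterRejects O x j τ) = if Γ.verifier x τ then 1 - pr (D.after O x j τ) else 0 := by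
  rw [afterRejects]
  cases Γ.verifier x τ with
  | true => simpa using pr_map_not (D.after O x j τ)
  | false => simpa [Function.const_def] using
      (congrArg pr (PMF.map_const (D.after O x j τ) false)).trans pr_pure_false

lemma bind_before_zero (O : Oracle PMF) (x : List Bool) (P : PMF Transcript) :
    P.bind (D.before O x 0) = D.reduction O x :=
  P.bind_const (D.reduction O x)

lemma bind_before_length (O : Oracle PMF) {x : List Bool} {P : PMF Transcript}
    (hP : ∀ τ ∈ P.support, τ.length = (Γ.coins x.length).length) :
    P.bind (D.before O x (Γ.coins x.length).length) =
      P.bind fun τ => PMF.pure (Γ.verifier x τ) :=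
  pmf_bind_congr fun _ hτ => D.before_length O x (hP _ hτ)

lemma afterBit_of_succ_lt (O : Oracle PMF) {x : List Bool} {j : ℕ}
    (hj : j + 1 < (Γ.coins x.length).length) : D.afterBit O x j = D.after O x j :=
  funext fun τ => by rw [afterBit, bit, decide_eq_true hj, Bool.true_or, if_pos rfl]

lemma length_of_mem_support_dist {x : List Bool} {τ : Transcript} (hτ : τ ∈ (D.dist x).support) :
    τ.length = (Γ.coins x.length).length := by
  obtain ⟨ρ, -, rfl⟩ := (PMF.mem_support_map_iff _ _ _).1 hτ
  exact D.length_sim _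

lemma length_of_mem_support_view {P : Strategy} {x : List Bool} {τ : Transcript}
    (hτ : τ ∈ (Γ.view P x).support) : τ.length = (Γ.coins x.length).length := by
  rw [← map_length_of_mem_support_view hτ, List.length_map]

lemma bind_after_zero (O : Oracle PMF) {x : List Bool} {P : PMF Transcript}
    (hP : ∀ τ ∈ P.support, (τ.getD 0 ([], [])).1 = []) :
    P.bind (D.after O x 0) = D.after O x 0 [] := by
  rw [← PMF.bind_const P (D.after O x 0 [])]
  refine pmf_bind_congr fun τ hτ => ?_
  rw [after, after, hP τ hτ]
  simp

lemma advantage_after_zero (O : Oracle PMF) (P : Strategy) {x : List Bool}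
    (h : (Γ.coins x.length).head? = some 0) :
    advantage (D.dist x) (Γ.view P x) (D.after O x 0) = 0 := by
  rw [advantage, D.bind_after_zero, D.bind_after_zero, sub_self, abs_zero]
  · intro τ hτ
    rw [← map_length_of_mem_support_view hτ] at h
    cases τ with
    | nil => rfl
    | cons a τ => simpa using h
  · intro τ hτ
    obtain ⟨ρ, -, rfl⟩ := (PMF.mem_support_map_iff _ _ _).1 hτ
    exact D.first_sim _ h

variable {D} {A : Oracle PMF} {x : List Bool} {P : Strategy} {ε : ℝ}

lemma HybridsIndist.sub_le_of_succ_lt (h : D.HybridsIndist A x (Γ.view P x) ε) {j : ℕ}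
    (hj : j + 1 < (Γ.coins x.length).length) :
    pr ((Γ.view P x).bind (D.before A x (j + 1))) - pr ((Γ.view P x).bind (D.before A x j)) ≤
      pr ((D.dist x).bind (D.before A x (j + 1))) - pr ((D.dist x).bind (D.afterBit A x j)) +
        ε + advantage (D.dist x) (Γ.view P x) (D.after A x j) := by
  have hbefore := neg_le_of_abs_le (h.before (j + 1) hj.le)
  have hafter := le_abs_self
    (pr ((D.dist x).bind (D.after A x j)) - pr ((Γ.view P x).bind (D.after A x j)))
  rw [D.afterBit_of_succ_lt A hj, D.view_bind_before A P x (j := j) (by omega),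
    advantage]
  linarith

/-- In the last round the verifier's decision on the transcript is part of the function value, so
that a single comparison suffices. -/
lemma HybridsIndist.sub_le_of_succ_eq (h : D.HybridsIndist A x (Γ.view P x) ε) {j : ℕ}
    (hj : j + 1 = (Γ.coins x.length).length) :
    pr ((Γ.view P x).bind (D.before A x (j + 1))) - pr ((Γ.view P x).bind (D.before A x j)) ≤
      pr ((D.dist x).bind (D.before A x (j + 1))) - pr ((D.dist x).bind (D.afterBit A x j)) +
        ε := by
  have hrejects := neg_le_of_abs_le (h.afterRejects j (by omega))
  have hsim : pr ((D.dist x).bind (D.before A x (j + 1))) =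
      pr ((D.dist x).bind (D.afterBit A x j)) + pr ((D.dist x).bind (D.afterRejects A x j)) := by
    rw [hj, D.bind_before_length A fun _ => D.length_of_mem_support_dist]
    refine pr_bind_add fun τ => ?_
    rw [pr_afterRejects, pr_pure, afterBit, bit, hj, decide_eq_false (lt_irrefl _), Bool.false_or]
    split_ifs
    · ring
    · rw [pr_pure_false, add_zero]
  have hview : pr ((Γ.view P x).bind (D.before A x (j + 1))) ≤
      pr ((Γ.view P x).bind (D.after A x j)) + pr ((Γ.view P x).bind (D.afterRejects A x j)) := by
    rw [hj, D.bind_before_length A fun _ => length_of_mem_support_view]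
    refine pr_bind_le_add fun τ => ?_
    rw [pr_afterRejects, pr_pure]
    split_ifs
    · linarith
    · linarith [pr_nonneg (D.after A x j τ)]
  rw [D.view_bind_before A P x (j := j) (by omega)]
  linarith

lemma HybridsIndist.sum_advantage_after_le (h : D.HybridsIndist A x (Γ.view P x) ε) {t K : ℕ}
    (ht : 2 ≤ t) (hK : (Γ.coins x.length).length = K + 1)
    (hmsg : t = 2 * (Γ.coins x.length).length ∨
      (t + 1 = 2 * (Γ.coins x.length).length ∧ (Γ.coins x.length).head? = some 0)) :
    ∑ j ∈ Finset.range K, advantage (D.dist x) (Γ.view P x) (D.after A x j) ≤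
      ((t : ℝ) - 1 - (K + 1)) * ε := by
  have hafter : ∀ j ∈ Finset.range K, advantage (D.dist x) (Γ.view P x) (D.after A x j) ≤ ε :=
    fun j hj => h.after j (by rw [Finset.mem_range] at hj; omega)
  rw [hK] at hmsg
  rcases hmsg with rfl | ⟨ht', hhead⟩
  · refine (Finset.sum_le_card_nsmul _ _ _ hafter).trans_eq ?_
    rw [Finset.card_range, nsmul_eq_mul]
    push_cast
    ring
  · obtain ⟨K, rfl⟩ := Nat.exists_eq_succ_of_ne_zero (show K ≠ 0 by omega)
    rw [Finset.sum_range_succ', D.advantage_after_zero A P hhead, add_zero]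
    refine (Finset.sum_le_card_nsmul _ _ ε fun j hj => hafter _ ?_).trans_eq ?_
    · simpa using hj
    · obtain rfl : t = 2 * K + 3 := by omega
      rw [Finset.card_range, nsmul_eq_mul]
      push_cast
      ring

theorem HybridsIndist.reduction_ge {t : ℕ} {δ : ℝ} (h : D.HybridsIndist A x (Γ.view P x) ε)
    (ht : 2 ≤ t)
    (hmsg : t = 2 * (Γ.coins x.length).length ∨
      (t + 1 = 2 * (Γ.coins x.length).length ∧ (Γ.coins x.length).head? = some 0))
    (hA : DistInverts A D.fn x (D.inLen.eval x.length) δ) :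
    Γ.acceptProb P x - ((t : ℝ) - 1) * ε - t * δ ≤ pr (D.reduction A x) := by
  obtain ⟨K, hK⟩ := Nat.exists_eq_succ_of_ne_zero
    (show (Γ.coins x.length).length ≠ 0 by omega)
  rw [Nat.succ_eq_add_one] at hK
  have hrounds := Finset.sum_le_sum (s := Finset.range K) fun j hj =>
    h.sub_le_of_succ_lt (j := j) (by rw [Finset.mem_range] at hj; omega)
  have hlast := h.sub_le_of_succ_eq hK.symm
  have hgap := sum_gap_le (t := t) (by omega) (by omega) hA
  have hafter := h.sum_advantage_after_le ht hK hmsg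
  rw [hK, Finset.sum_range_succ] at hgap
  rw [Finset.sum_range_sub fun j => pr ((Γ.view P x).bind (D.before A x j)),
    Finset.sum_add_distrib, Finset.sum_add_distrib, Finset.sum_const, Finset.card_range,
    nsmul_eq_mul, D.bind_before_zero] at hrounds
  have haccept : pr ((Γ.view P x).bind (D.before A x (K + 1))) = Γ.acceptProb P x := by
    rw [← hK, D.bind_before_length A fun _ => length_of_mem_support_view]
    rfl
  rw [haccept] at hlast
  linarith

end Simulator

lemma Protocol.Sound.computationallySound {Γ : Protocol} {L : Language Bool} {ε : ℕ → ℝ}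
    (h : Γ.Sound L ε) : Γ.ComputationallySound L ε :=
  fun _ _ _ => .of_forall fun _ x hx hxL => hx ▸ h x hxL _

end PublicCoinZK

theorem lemma3p2_general {εc εs εz : ℕ → ℝ} {t : ℕ → ℕ} (ht : ∀ n, 2 ≤ t n) {L : Language Bool}
    {Rel : List Bool → List Bool → Prop} (hL : ∀ x ∈ L, ∃ w, Rel x w) {Γ : Protocol}
    (hmsg : Γ.HasMessages t) (hver : Γ.EfficientVerifier) (hcomplete : Γ.Complete Rel εc)
    (hsound : Γ.ComputationallySound L εs) (hzk : Γ.ZeroKnowledge Rel εz) :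
    ∃ (R : Oracle PMF → List Bool → PMF Bool) (f : List Bool → List Bool → List Bool)
      (m₁ m₂ : Polynomial ℕ),
      OraclePolyTime R ∧ IsPolyTimeFamily f m₁ m₂ ∧
      ∀ A : List Bool × List Bool → PMF (List Bool), PPT A →
        ∀ᶠ n : ℕ in Filter.atTop, ∀ x : List Bool, x.length = n →
          (x ∈ L → ∀ δ : ℝ, DistInverts A f x (m₁.eval n) δ →
            1 - εc n - ((t n : ℝ) - 1) * εz n - t n * δ ≤ (R A x true).toReal) ∧
          (x ∉ L → (R A x true).toReal ≤ εs n) := by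
  obtain ⟨Sim, hSim, hzk⟩ := hzk
  obtain ⟨D, hD⟩ := exists_simulator hver hSim
  refine ⟨D.reduction, D.fn, D.inLen, D.serLen, D.oraclePolyTime_reduction,
    D.isPolyTimeFamily_fn, fun A hA => ?_⟩
  filter_upwards [hsound (D.prover A) (D.ppt_prover hA) (D.exists_length_prover_le A),
    D.eventually_hybridsIndist hD hzk hA] with n hreject hhybrids x hx
  refine ⟨fun hxL δ hinv => ?_, hreject x hx⟩
  subst hx
  obtain ⟨w, hw⟩ := hL x hxL
  have haccept := hcomplete x w hw
  have hge := (hhybrids x w rfl hw).reduction_ge (ht _) (hmsg _) hinv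
  exact (sub_le_sub_right (sub_le_sub_right haccept _) _).trans hge

theorem lemma3p2 (εc εs εz : ℕ → unitInterval) (t : ℕ → ℕ) (ht : ∀ n, 2 ≤ t n)
    (L : Language Bool) (Rel : List Bool → List Bool → Prop) (hNP : IsNPRelation L Rel)
    (Γ : Protocol) (hmsg : Γ.HasMessages t)
    (hZK : Γ.IsZKProof L Rel (fun n => εc n) (fun n => εs n) (fun n => εz n) ∨
      Γ.IsZKArgument L Rel (fun n => εc n) (fun n => εs n) (fun n => εz n)) :
    ∃ (R : Oracle PMF → List Bool → PMF Bool) (f : List Bool → List Bool → List Bool)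
      (m₁ m₂ : Polynomial ℕ),
      OraclePolyTime R ∧ IsPolyTimeFamily f m₁ m₂ ∧
      ∀ (A : List Bool × List Bool → PMF (List Bool)), PPT A → ∀ p : Polynomial ℝ,
        ∀ᶠ n : ℕ in Filter.atTop, ∀ x : List Bool, x.length = n →
          (x ∈ L → DistInverts A f x (m₁.eval n) (1 / p.eval (n : ℝ)) →
            1 - (εc n : ℝ) - ((t n : ℝ) - 1) * (εz n : ℝ) - (t n : ℝ) / p.eval (n : ℝ) ≤
              (R A x true).toReal) ∧
          (x ∉ L → (R A x true).toReal ≤ (εs n : ℝ)) := by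
  have hL : ∀ x ∈ L, ∃ w, Rel x w := fun x hx => (hNP.2.2 x).1 hx
  obtain ⟨hver, hcomplete, hsound, hzk⟩ : Γ.EfficientVerifier ∧ Γ.Complete Rel (fun n => εc n) ∧
      Γ.ComputationallySound L (fun n => εs n) ∧ Γ.ZeroKnowledge Rel (fun n => εz n) := by
    rcases hZK with ⟨hver, -, hcomplete, hsound, hzk⟩ | ⟨hver, -, -, hcomplete, hsound, hzk⟩
    · exact ⟨hver, hcomplete, hsound.computationallySound, hzk⟩
    · exact ⟨hver, hcomplete, hsound, hzk⟩
  obtain ⟨R, f, m₁, m₂, hR, hf, h⟩ :=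
    lemma3p2_general ht hL hmsg hver hcomplete hsound hzk
  refine ⟨R, f, m₁, m₂, hR, hf, fun A hA p => (h A hA).mono fun n hn x hx => ?_⟩
  obtain ⟨hin, hout⟩ := hn x hx
  exact ⟨fun hxL hinv => mul_one_div (t n : ℝ) _ ▸ hin hxL _ hinv, hout⟩
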